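/- **Notation.** $\mathcal W_0$ is the set of all continuous non-decreasing $\omega:[0,\infty)\to[0,\infty)$ with $\omega(t)=0$ for $t\in[0,1]$, $\omega(t)\to+\infty$ and $\log t=o(\omega(t))$ as $t\to+\infty$, and such that $y\mapsto\omega(e^y)$ is convex on $\mathbb R$. For functions $\sigma,\tau$ on $[0,\infty)$ write $\sigma\sim\tau$ if $\sigma=O(\tau)$ and $\tau=O(\sigma)$ as $t\to+\infty$; $\sigma$ has $(\omega_1)$ if $\exists L\ge1\ \forall t\ge0:\ \sigma(2t)\le L(\sigma(t)+1)$, and $(\omega_6)$ if $\exists H\ge1\ \forall t\ge0:\ 2\sigma(t)\le\sigma(Ht)+H$. Let $$\overline\gamma(\sigma):=\inf\Big\{\gamma>0:\ \exists A>1:\ \liminf_{t\to+\infty}\frac{\sigma(A^\gamma t)}{\sigma(t)}>A\Big\}\in[0,+\infty],\qquad \sigma^*(s):=\sup_{t\ge0}\{st-\sigma(t)\}\quad(s\ge0).$$ For a positive sequence $\mathbf M=(M_p)_{p\in\mathbb N}$ let $m_p:=M_p/p!$, $\mathbf m:=(m_p)_p$, $\mu_p:=M_p/M_{p-1}$ $(p\ge1)$,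 $\mu_0:=1$, $M^*_p:=p!/M_p$, $\mathbf M^*:=(M_p^*)_p$, and $\omega_{\mathbf M}(t):=\sup_{p\in\mathbb N}\log\frac{M_0t^p}{M_p}$ for $t\ge0$ (with $0^0=1$, $\log 0=-\infty$). $\mathbf M$ is log-convex if $M_p^2\le M_{p-1}M_{p+1}$ for all $p\ge1$, log-concave if the reverse inequality holds for all $p\ge1$, a weight sequence if $(M_p)^{1/p}\to+\infty$, and $\mathbf M\in\mathcal{LC}$ if it is a log-convex weight sequence with $1=M_0\le M_1$. $\mathbf M$ has (mg) if $\exists C\ge1\ \forall p,q\in\mathbb N:\ M_{p+q}\le C^{p+q+1}M_pM_q$. Write $\mathbf M\approx\mathbf N$ if $\sup_{p\ge1}(M_p/N_p)^{1/p}<\infty$ and $\sup_{p\ge1}(N_p/M_p)^{1/p}<\infty$. A sequence $(a_p)_{p\geq 1}$ is almost decreasing if $\exists H\ge1\ \forall1\le p\le q:\ a_q\le Ha_p$. A family $\{\mathbf M^{(\ell)}:\ell>0\}$ is constant if $\mathbf M^{(\ell_1)}\approx\mathbf M^{(\ell_2)}$ for all $\ell_1,\ell_2>0$. For $\omega\in\mathcal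 W_0$ let $\varphi^*_\omega(x):=\sup_{y\ge0}\{xy-\omega(e^y)\}$ $(x\ge0)$, $W^{(\ell)}_p:=\exp\big(\tfrac1\ell\varphi^*_\omega(\ell p)\big)$, $\mathbf W^{(\ell)}:=(W^{(\ell)}_p)_{p\in\mathbb N}$ with quotients $\vartheta^{(\ell)}_p$, $\mathcal M_\omega:=\{\mathbf W^{(\ell)}:\ell>0\}$ and $\mathcal M_\omega^*:=\{(\mathbf W^{(1/\ell)})^*:\ell>0\}$. Below, $\omega^*_{\mathbf W^{(\ell)}}$ means $(\omega_{\mathbf W^{(\ell)}})^*$. **Theorem 5.5.** Let $\omega\in\mathcal W_0$ with $t=o(\omega(t))$ as $t\to+\infty$. Then $\varphi^*_\omega$, $\omega^*$ and, for every $\ell>0$, the functions $\omega_{\mathbf W^{(\ell)}}$, $\omega^*_{\mathbf W^{(\ell)}}$ and $\omega_{(\mathbf W^{(\ell)})^*}$ are well defined (finite on $[0,\infty)$), and the following hold. (i) For every $\ell>0$ there is $D_\ell\ge1$ such that $\ell\,\omega_{\mathbf W^{(\ell)}}(t)\le\omega(t)\le2\ell\,\omega_{\mathbf W^{(\ell)}}(t)+D_\ell$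 for all $t\ge0$ and $$\frac1\ell\,\omega^*(s\ell)\le\omega^*_{\mathbf W^{(\ell)}}(s)\le\frac1{2\ell}\,\omega^*(2\ell s)+\frac{D_\ell}{2\ell}\qquad\text{for all }s\ge0.$$ (ii) If in addition $\overline\gamma(\omega)<1$, then: (a) $\omega^*$ has $(\omega_1)$; (b) for every $\ell>0$, $\omega^*\sim\omega^*_{\mathbf W^{(\ell)}}$ and $\omega^*_{\mathbf W^{(\ell)}}$ has $(\omega_1)$; (c) for every $\ell>0$, $\omega_{(\mathbf W^{(\ell)})^*}$ has $(\omega_1)$ and $\omega^*\sim\omega^*_{\mathbf W^{(\ell)}}\sim\omega_{(\mathbf W^{(\ell)})^*}$; (d) $\mathcal M_\omega$ and $\mathcal M^*_\omega$ are constant, and all $\mathbf W^{(\ell)}$ and $(\mathbf W^{(\ell)})^*$ have (mg); (e) for every $\ell>0$ there is $\mathbf V^{(\ell)}\approx\mathbf W^{(\ell)}$ such that $\mathbf V^{(\ell)}$ is log-convex, $\mathbf v^{(\ell)}=(V^{(\ell)}_p/p!)_p$ is log-concave, and $\mathbf V^{(\ell)},(\mathbf V^{(\ell)})^*\in\mathcal{LC}$;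 (f) if moreover $\omega$ has $(\omega_1)$, then $\overline\gamma(\omega^*)<1$, and $\omega^*$ has $(\omega_6)$. (iii) $\mathcal M_\omega$ and $\mathcal M_\omega^*$ are constant, and $\omega$ has $(\omega_6)$, if at least one of the following holds: (a) for some $\ell_0>0$, $\big(\vartheta^{(\ell_0)}_p/p\big)_{p\ge1}$ is almost decreasing; (b) $\omega$ has $(\omega_1)$, and for some $\ell_0>0$ there is a log-convex weight sequence $\mathbf N$ with $\mathbf W^{(\ell_0)}\approx\mathbf N$ whose quotients $\nu_p$ are such that $(\nu_p/p)_{p\ge1}$ is almost decreasing; (c) for some $\ell_0>0$ there is a log-convex positive sequence $\mathbf N$ with $\mathbf N\approx\mathbf W^{(\ell_0)}$ such that $p\mapsto(n_p)^{1/p}$, $n_p=N_p/p!$, is non-increasing on $p\ge1$. Moreover, each of (a) and (b) implies $\overline\gamma(\omega)\le1$. -/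

import Mathlib

open Set Filter Topology Asymptotics

namespace BMT

noncomputable section

/-! Functions on `[0,∞)` are represented by functions `ℝ → ℝ`; every notion below
depends only on the values at arguments `t ≥ 0`. -/

/-! ### Weight functions -/

/-- Normalized weight functions in the sense of Braun-Meise-Taylor. -/
structure InW0 (ω : ℝ → ℝ) : Prop where
  continuousOn : ContinuousOn ω (Ici 0)
  monotoneOn : MonotoneOn ω (Ici 0)
  /-- normalization; in particular `ω 0 = 0`, and so `ω ≥ 0` on `[0,∞)` -/
  eq_zero : ∀ t ∈ Icc (0 : ℝ) 1, ω t = 0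
  tendsto : Tendsto ω atTop atTop
  /-- `log t = o(ω(t))` as `t → ∞` -/
  log_isLittleO : Real.log =o[atTop] ω
  /-- `y ↦ ω(exp y)` is convex on `ℝ` -/
  convex : ConvexOn ℝ univ (fun y : ℝ => ω (Real.exp y))

/-- Condition `(ω₁)`. -/
def Om1 (ω : ℝ → ℝ) : Prop :=
  ∃ L : ℝ, 1 ≤ L ∧ ∀ t : ℝ, 0 ≤ t → ω (2 * t) ≤ L * (ω t + 1)

/-- Condition `(ω₆)`. -/
def Om6 (ω : ℝ → ℝ) : Prop :=
  ∃ H : ℝ, 1 ≤ H ∧ ∀ t : ℝ, 0 ≤ t → 2 * ω t ≤ ω (H * t) + H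

/-- Equivalence `σ ∼ τ` of weight functions: `σ = O(τ)` and `τ = O(σ)` at `+∞`. -/
def FunEquiv (σ τ : ℝ → ℝ) : Prop :=
  τ =O[atTop] σ ∧ σ =O[atTop] τ

/-- Property `(P̄_{ω,γ})`: there is `A > 1` with
`liminf_{t → ∞} ω(A^γ t) / ω(t) > A`, the lower limit being taken in `[-∞,∞]`. -/
def PBar (ω : ℝ → ℝ) (γ : ℝ) : Prop :=
  ∃ A : ℝ, 1 < A ∧
    (A : EReal) < liminf (fun t : ℝ => ((ω (A ^ γ * t) / ω t : ℝ) : EReal)) atTop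

/-- The growth index `γ̄(ω)`, with value `+∞` if no `(P̄_{ω,γ})` holds. -/
def gammaBar (ω : ℝ → ℝ) : EReal :=
  sInf ((fun γ : ℝ => (γ : EReal)) '' {γ : ℝ | 0 < γ ∧ PBar ω γ})

/-- The conjugate function `ω*(s) = sup_{t ≥ 0} (s t - ω(t))`. -/
def conj (ω : ℝ → ℝ) (s : ℝ) : ℝ :=
  sSup ((fun t : ℝ => s * t - ω t) '' Ici 0)

/-- `ω*` is well defined: the supremum is finite for every `s ≥ 0`. -/
def ConjWellDefined (ω : ℝ → ℝ) : Prop :=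
  ∀ s : ℝ, 0 ≤ s → BddAbove ((fun t : ℝ => s * t - ω t) '' Ici 0)

/-! ### Sequences -/

/-- The quotients `μ_p = M_p / M_{p-1}` for `p ≥ 1`, and `μ_0 = 1`. -/
def quot (M : ℕ → ℝ) (p : ℕ) : ℝ :=
  if p = 0 then 1 else M p / M (p - 1)

/-- The sequence `m_p = M_p / p!`. -/
def small (M : ℕ → ℝ) (p : ℕ) : ℝ := M p / (p.factorial : ℝ)

/-- The conjugate sequence `M*_p = p! / M_p`. -/
def seqConj (M : ℕ → ℝ) (p : ℕ) : ℝ := (p.factorial : ℝ) / M p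

def LogConvex (M : ℕ → ℝ) : Prop :=
  ∀ p : ℕ, 1 ≤ p → M p ^ 2 ≤ M (p - 1) * M (p + 1)

def LogConcave (M : ℕ → ℝ) : Prop :=
  ∀ p : ℕ, 1 ≤ p → M (p - 1) * M (p + 1) ≤ M p ^ 2

/-- A (positive) weight sequence: `(M_p)^{1/p} → ∞`. -/
structure IsWeightSequence (M : ℕ → ℝ) : Prop where
  pos : ∀ p, 0 < M p
  tendsto : Tendsto (fun p : ℕ => (M p) ^ (1 / (p : ℝ))) atTop atTop

/-- The class of normalized log-convex weight sequences. -/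
structure InLC (M : ℕ → ℝ) : Prop extends IsWeightSequence M where
  zero_eq : M 0 = 1
  one_le : 1 ≤ M 1
  logConvex : LogConvex M

/-- Moderate growth. -/
def ModerateGrowth (M : ℕ → ℝ) : Prop :=
  ∃ C : ℝ, 1 ≤ C ∧ ∀ p q : ℕ, M (p + q) ≤ C ^ (p + q + 1) * M p * M q

/-- `M ⪯ N`: `sup_{p ≥ 1} (M_p / N_p)^{1/p} < ∞`. -/
def SeqPreceq (M N : ℕ → ℝ) : Prop :=
  BddAbove ((fun p : ℕ => (M p / N p) ^ (1 / (p : ℝ))) '' Ici 1)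

/-- Equivalence `M ≈ N` of sequences. -/
def SeqEquiv (M N : ℕ → ℝ) : Prop := SeqPreceq M N ∧ SeqPreceq N M

/-- `(a_p)_{p ≥ 1}` is almost decreasing. -/
def AlmostDecreasing (a : ℕ → ℝ) : Prop :=
  ∃ H : ℝ, 1 ≤ H ∧ ∀ p q : ℕ, 1 ≤ p → p ≤ q → a q ≤ H * a p

/-- The associated function `ω_M(t) = sup_p log (M_0 t^p / M_p)`, where `0^0 = 1`.
For `t = 0` the convention `log 0 = -∞` makes the supremum `0`, attained at `p = 0`; with
`Real.log 0 = 0` all terms are `0` and the value is the same. -/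
def assoc (M : ℕ → ℝ) (t : ℝ) : ℝ :=
  sSup (range fun p : ℕ => Real.log (M 0 * t ^ p / M p))

/-- `ω_M` is well defined: the supremum is finite for every `t ≥ 0`. -/
def AssocWellDefined (M : ℕ → ℝ) : Prop :=
  ∀ t : ℝ, 0 ≤ t → BddAbove (range fun p : ℕ => Real.log (M 0 * t ^ p / M p))

/-! ### The associated weight matrix -/

/-- The Young conjugate `φ*_ω(x) = sup_{y ≥ 0} (x y - ω(exp y))`. -/
def young (ω : ℝ → ℝ) (x : ℝ) : ℝ :=
  sSup ((fun y : ℝ => x * y - ω (Real.exp y)) '' Ici 0)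

/-- `φ*_ω` is well defined: the supremum is finite for every `x ≥ 0`. -/
def YoungWellDefined (ω : ℝ → ℝ) : Prop :=
  ∀ x : ℝ, 0 ≤ x → BddAbove ((fun y : ℝ => x * y - ω (Real.exp y)) '' Ici 0)

/-- The associated weight matrix: `W^(ℓ)_p = exp (φ*_ω(ℓ p) / ℓ)`, for `ℓ > 0`. -/
def matrixW (ω : ℝ → ℝ) (l : ℝ) (p : ℕ) : ℝ :=
  Real.exp (1 / l * young ω (l * (p : ℝ)))

/-- The conjugate weight matrix `{(W^(1/ℓ))* : ℓ > 0}`. -/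
def matrixWConj (ω : ℝ → ℝ) (l : ℝ) : ℕ → ℝ :=
  seqConj (matrixW ω (1 / l))

/-- A matrix `{M^(ℓ) : ℓ > 0}` is constant if all its members are equivalent. -/
def ConstantMatrix (M : ℝ → ℕ → ℝ) : Prop :=
  ∀ l₁ l₂ : ℝ, 0 < l₁ → 0 < l₂ → SeqEquiv (M l₁) (M l₂)

end

end BMT

namespace BMT

/-! ### Weight functions: elementary bounds -/

section Basic

variable {ω : ℝ → ℝ}

/-! Every growth condition becomes a dilation inequality, and conjugation carries such inequalities
from one object to another. The condition `gammaBar ω < 1` yields `2Q ω(t) ≤ ω(Qt) + D` with some `Q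
> 1` (`exists_dilate_of_gammaBar_lt_one`). The conjugate `ω*` turns this into doubling, and turns
doubling of `ω` back into such an inequality. In the variable `y = log t` a dilation is a
translation, so for the Young conjugate `φ*` it reads `φ*(Rx) ≤ R φ*(x) + R x log Q + D`. By
biconjugation, available because `ω ∘ exp` is convex, such bounds also lead back to `ω`.

The matrix enters through `log W_p / p = φ*(lp)/(lp)`, where `φ*(x)/x` is non-decreasing. If
`φ*(x)/x` grows boundedly under doubling of `x`, the matrix is constant and has moderate growth. If
it grows at most like `log x` up to a constant, then `W_p^{1/p}/p` is almost decreasing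
(`RootAlmostDecreasing`). This implies `(ω₆)` and `gammaBar ω ≤ 1`, and it allows a regularization
that is log-convex with log-concave `V_p/p!`.

The associated functions are compared with `ω` and `ω*` by rounding real maximizers to integers, and
by the fact that `sup_p x^p/p!` lies between `exp(x/2)/4` and `exp x` for `x > 0`. -/

lemma InW0.nonneg (hω : InW0 ω) {t : ℝ} (ht : 0 ≤ t) : 0 ≤ ω t := by
  rw [← hω.eq_zero 0 ⟨le_rfl, zero_le_one⟩]
  exact hω.monotoneOn (mem_Ici.2 le_rfl) ht ht

/-- Monotonicity bounds `h` on the initial range where the asymptotic estimate is not yet in force.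
-/
lemma exists_le_mul_add_of_isLittleO (hω : ∀ t, 0 ≤ t → 0 ≤ ω t) {h : ℝ → ℝ} {a : ℝ} (ha : 0 ≤ a)
    (hmono : MonotoneOn h (Ici a)) (ho : h =o[atTop] ω) {c : ℝ} (hc : 0 < c) :
    ∃ D : ℝ, 0 ≤ D ∧ ∀ t, a ≤ t → h t ≤ c * ω t + D := by
  obtain ⟨T, hT⟩ := eventually_atTop.1 (ho.bound hc)
  refine ⟨|h (max T a)|, abs_nonneg _, fun t ht => ?_⟩
  have h0 := hω t (ha.trans ht)
  rcases le_total T t with h1 | h1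
  · have := hT t h1
    rw [Real.norm_eq_abs, Real.norm_eq_abs, abs_of_nonneg h0] at this
    linarith [le_abs_self (h t), abs_nonneg (h (max T a))]
  · have := hmono ht (le_max_right T a) (h1.trans (le_max_left T a))
    have := mul_nonneg hc.le h0
    linarith [le_abs_self (h (max T a))]

lemma InW0.log_le (hω : InW0 ω) {c : ℝ} (hc : 0 < c) :
    ∃ D : ℝ, 0 ≤ D ∧ ∀ t, 1 ≤ t → Real.log t ≤ c * ω t + D :=
  exists_le_mul_add_of_isLittleO (fun _ => hω.nonneg) zero_le_one
    (fun _ hx _ _ hxy => Real.log_le_log (zero_lt_one.trans_le hx) hxy) hω.log_isLittleO hc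

lemma InW0.id_le (hω : InW0 ω) (h : (fun t : ℝ => t) =o[atTop] ω) {c : ℝ} (hc : 0 < c) :
    ∃ D : ℝ, 0 ≤ D ∧ ∀ t, 0 ≤ t → t ≤ c * ω t + D :=
  exists_le_mul_add_of_isLittleO (fun _ => hω.nonneg) le_rfl (fun _ _ _ _ hxy => hxy) h hc

end Basic

/-! ### The Young conjugate -/

section Young

variable {ω : ℝ → ℝ}

lemma InW0.youngWellDefined (hω : InW0 ω) : YoungWellDefined ω := by
  intro x hx
  -- This choice of `c` gives `x * c ≤ 1` and stays meaningful at `x = 0`.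
  obtain ⟨D, hD, h⟩ := hω.log_le (c := 1 / (x + 1)) (by positivity)
  refine ⟨x * D, ?_⟩
  rintro _ ⟨y, hy, rfl⟩
  have h1 := h (Real.exp y) (Real.one_le_exp hy)
  rw [Real.log_exp] at h1
  have h0 := hω.nonneg (Real.exp_pos y).le
  have h2 : x * (1 / (x + 1)) ≤ 1 := by
    rw [mul_one_div, div_le_one (by positivity)]; linarith
  have h3 := mul_le_mul_of_nonneg_left h1 hx
  have h4 := mul_le_mul_of_nonneg_right h2 h0
  simp only
  nlinarith

lemma young_le {x B : ℝ} (h : ∀ y, 0 ≤ y → x * y - ω (Real.exp y) ≤ B) : young ω x ≤ B :=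
  csSup_le ((nonempty_Ici).image _) (by rintro _ ⟨y, hy, rfl⟩; exact h y hy)

lemma InW0.young_nonneg (hω : InW0 ω) {x : ℝ} (hx : 0 ≤ x) : 0 ≤ young ω x := by
  have := le_csSup (hω.youngWellDefined x hx) (mem_image_of_mem _ (mem_Ici.2 (le_refl (0:ℝ))))
  simp only [Real.exp_zero, hω.eq_zero 1 ⟨zero_le_one, le_rfl⟩, mul_zero, sub_zero] at this
  exact this

/-- For `y ≤ 0` the left side is nonpositive, so restricting the supremum to `y ≥ 0` loses nothing.
Translations in `y` are therefore unrestricted below. -/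
lemma InW0.le_young (hω : InW0 ω) {x : ℝ} (hx : 0 ≤ x) (y : ℝ) :
    x * y - ω (Real.exp y) ≤ young ω x := by
  rcases le_total 0 y with hy | hy
  · exact le_csSup (hω.youngWellDefined x hx) (mem_image_of_mem _ (mem_Ici.2 hy))
  · have := hω.nonneg (Real.exp_pos y).le
    have := mul_nonpos_of_nonneg_of_nonpos hx hy
    linarith [hω.young_nonneg hx]

lemma InW0.young_zero (hω : InW0 ω) : young ω 0 = 0 := by
  refine le_antisymm (young_le fun y _ => ?_) (hω.young_nonneg le_rfl)
  linarith [hω.nonneg (Real.exp_pos y).le]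

lemma InW0.young_mono (hω : InW0 ω) {x x' : ℝ} (hx : 0 ≤ x) (h : x ≤ x') :
    young ω x ≤ young ω x' :=
  young_le fun y hy => by
    have := hω.le_young (hx.trans h) y
    nlinarith

/-- Since `ω ≥ 0`, multiplying `ω` by `a ≥ 1` only lowers the terms. This is the source of the
monotonicity of `φ*(x)/x`, which later bridges gaps between sample points. -/
lemma InW0.mul_young_le (hω : InW0 ω) {a x : ℝ} (ha : 1 ≤ a) (hx : 0 ≤ x) :
    a * young ω x ≤ young ω (a * x) := by
  have ha0 : 0 < a := zero_lt_one.trans_le ha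
  rw [← le_div_iff₀' ha0]
  refine young_le fun y _ => ?_
  rw [le_div_iff₀' ha0]
  have := hω.le_young (mul_nonneg ha0.le hx) y
  have := hω.nonneg (Real.exp_pos y).le
  nlinarith

lemma InW0.young_div_le (hω : InW0 ω) {x x' : ℝ} (hx : 0 < x) (h : x ≤ x') :
    young ω x / x ≤ young ω x' / x' := by
  have := hω.mul_young_le (a := x' / x) ((one_le_div hx).2 h) hx.le
  rw [div_mul_cancel₀ _ hx.ne'] at this
  rw [le_div_iff₀ (hx.trans_le h)]
  calc _ = x' / x * young ω x := by ring
    _ ≤ _ := this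

lemma InW0.young_midpoint (hω : InW0 ω) {x x' : ℝ} (hx : 0 ≤ x) (hx' : 0 ≤ x') :
    2 * young ω ((x + x') / 2) ≤ young ω x + young ω x' := by
  rw [← le_div_iff₀' two_pos]
  refine young_le fun y _ => ?_
  have := hω.le_young hx y
  have := hω.le_young hx' y
  rw [le_div_iff₀' two_pos]
  linarith

lemma InW0.young_superadd (hω : InW0 ω) {x x' : ℝ} (hx : 0 ≤ x) (hx' : 0 ≤ x') :
    young ω x + young ω x' ≤ young ω (x + x') := by
  rcases hx.eq_or_lt with rfl | h1
  · simp [hω.young_zero]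
  rcases hx'.eq_or_lt with rfl | h2
  · simp [hω.young_zero]
  have h3 := hω.young_div_le h1 (le_add_of_nonneg_right hx' : x ≤ x + x')
  have h4 := hω.young_div_le h2 (le_add_of_nonneg_left hx : x' ≤ x + x')
  rw [div_le_iff₀ h1] at h3
  rw [div_le_iff₀ h2] at h4
  have : young ω (x + x') = young ω (x + x') / (x + x') * x + young ω (x + x') / (x + x') * x' := by
    field_simp
  linarith

lemma _root_.ConvexOn.exists_subgradient {φ : ℝ → ℝ} (h : ConvexOn ℝ univ φ) (y : ℝ) :
    ∃ x : ℝ, ∀ z, φ y + x * (z - y) ≤ φ z := by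
  refine ⟨derivWithin φ (Ioi y) y, fun z => ?_⟩
  rcases lt_trichotomy z y with hz | rfl | hz
  · have h1 := h.slope_le_leftDeriv_of_mem_interior (mem_univ z) (y := y) (by simp) hz
    have h2 := h.leftDeriv_le_rightDeriv_of_mem_interior (x := y) (by simp)
    have h3 := h1.trans h2
    rw [slope_def_field, div_le_iff₀ (sub_pos.2 hz)] at h3
    linarith
  · simp
  · have h1 := h.rightDeriv_le_slope_of_mem_interior (x := y) (by simp) (mem_univ z) hz
    rw [slope_def_field, le_div_iff₀ (sub_pos.2 hz)] at h1
    linarith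

/-- The biconjugate of `y ↦ ω (exp y)` is attained. -/
lemma InW0.exists_young_eq (hω : InW0 ω) (y : ℝ) :
    ∃ x, 0 ≤ x ∧ ω (Real.exp y) + young ω x ≤ x * y := by
  obtain ⟨x, hx⟩ := hω.convex.exists_subgradient y
  have hx0 : 0 ≤ x := by
    have h1 := hx (y - 1)
    have h2 : ω (Real.exp (y - 1)) ≤ ω (Real.exp y) :=
      hω.monotoneOn (Real.exp_pos _).le (Real.exp_pos _).le (Real.exp_le_exp.2 (by linarith))
    linarith
  refine ⟨x, hx0, ?_⟩
  have : young ω x ≤ x * y - ω (Real.exp y) := young_le fun z _ => by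
    have := hx z
    linarith
  linarith

/-- A dilation inequality for `ω` passes to the Young conjugate. -/
lemma InW0.young_dilate (hω : InW0 ω) {R Q D : ℝ} (hR : 1 ≤ R) (hQ : 0 < Q)
    (h : ∀ t, 0 ≤ t → R * ω t ≤ ω (Q * t) + D) {x : ℝ} (hx : 0 ≤ x) :
    young ω (R * x) ≤ R * young ω x + R * x * Real.log Q + D := by
  refine young_le fun y _ => ?_
  -- Translating `y` by `log Q` undoes the dilation by `Q`.
  have h1 := h (Real.exp (y - Real.log Q)) (Real.exp_pos _).le
  rw [Real.exp_sub, Real.exp_log hQ, mul_div_cancel₀ _ hQ.ne'] at h1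
  have h2 := hω.le_young hx (y - Real.log Q)
  rw [Real.exp_sub, Real.exp_log hQ] at h2
  have := mul_le_mul_of_nonneg_left h2 (zero_le_one.trans hR)
  linarith

/-- A dilation inequality for the Young conjugate passes to `ω`. -/
lemma InW0.dilate_of_young (hω : InW0 ω) {R h D : ℝ} (hR : 1 ≤ R) (hD : 0 ≤ D)
    (H : ∀ x, 0 ≤ x → young ω (R * x) ≤ R * young ω x + R * x * h + D) {t : ℝ} (ht : 0 ≤ t) :
    R * ω t ≤ ω (Real.exp h * t) + D := by
  rcases ht.eq_or_lt with rfl | ht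
  · simp [hω.eq_zero 0 ⟨le_rfl, zero_le_one⟩, hD]
  obtain ⟨x, hx, h1⟩ := hω.exists_young_eq (Real.log t)
  rw [Real.exp_log ht] at h1
  have h2 := hω.le_young (mul_nonneg (zero_le_one.trans hR) hx) (Real.log t + h)
  rw [Real.exp_add, Real.exp_log ht, mul_comm t] at h2
  have h3 := H x hx
  have := mul_le_mul_of_nonneg_left h1 (zero_le_one.trans hR)
  linarith

end Young

/-! ### The conjugate `ω*` -/

section Conj

variable {σ : ℝ → ℝ}

lemma conj_le {s B : ℝ} (h : ∀ t, 0 ≤ t → s * t - σ t ≤ B) : conj σ s ≤ B :=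
  csSup_le ((nonempty_Ici).image _) (by rintro _ ⟨y, hy, rfl⟩; exact h y hy)

lemma ConjWellDefined.le_conj (h : ConjWellDefined σ) {s t : ℝ} (hs : 0 ≤ s) (ht : 0 ≤ t) :
    s * t - σ t ≤ conj σ s :=
  le_csSup (h s hs) (mem_image_of_mem _ (mem_Ici.2 ht))

lemma ConjWellDefined.conj_mono (h : ConjWellDefined σ) {s s' : ℝ} (hs : 0 ≤ s) (hss : s ≤ s') :
    conj σ s ≤ conj σ s' :=
  conj_le fun t ht => by
    have := h.le_conj (hs.trans hss) ht
    nlinarith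

lemma ConjWellDefined.self_le_conj (h : ConjWellDefined σ) (h1 : σ 1 = 0) {s : ℝ} (hs : 0 ≤ s) :
    s ≤ conj σ s := by
  have := h.le_conj hs zero_le_one
  rw [h1] at this
  linarith

lemma ConjWellDefined.tendsto_conj (h : ConjWellDefined σ) (h1 : σ 1 = 0) :
    Tendsto (conj σ) atTop atTop :=
  tendsto_atTop_mono' _ ((eventually_ge_atTop 0).mono fun _ hs => h.self_le_conj h1 hs) tendsto_id

lemma InW0.conjWellDefined (hω : InW0 σ) (h : (fun t : ℝ => t) =o[atTop] σ) :
    ConjWellDefined σ := by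
  intro s hs
  obtain ⟨D, hD, hle⟩ := hω.id_le h (c := 1 / (s + 1)) (by positivity)
  refine ⟨s * D, ?_⟩
  rintro _ ⟨t, ht, rfl⟩
  have h1 := hle t ht
  have h0 := hω.nonneg ht
  have h2 : s * (1 / (s + 1)) ≤ 1 := by
    rw [mul_one_div, div_le_one (by positivity)]; linarith
  have h3 := mul_le_mul_of_nonneg_left h1 hs
  have h4 := mul_le_mul_of_nonneg_right h2 h0
  simp only
  nlinarith

end Conj

/-! ### Dilation inequalities and growth conditions -/

section Dilation

variable {σ τ : ℝ → ℝ}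

/-- `σ(2t) ≤ L (σ(t) + 1)` extends to arbitrary dilations. -/
lemma Om1.dilate (h : Om1 σ) (hmono : MonotoneOn σ (Ici 0)) (h0 : ∀ t, 0 ≤ t → 0 ≤ σ t)
    {a b : ℝ} (ha : 0 < a) (hb : 0 < b) :
    ∃ L : ℝ, 1 ≤ L ∧ ∀ t, 0 ≤ t → σ (b * t) ≤ L * (σ (a * t) + 1) := by
  obtain ⟨L, hL, hle⟩ := h
  have hpow : ∀ n : ℕ, ∃ K : ℝ, 1 ≤ K ∧ ∀ t, 0 ≤ t → σ (2 ^ n * t) ≤ K * (σ t + 1) := by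
    intro n
    induction n with
    | zero => exact ⟨1, le_rfl, fun t _ => by simp⟩
    | succ n ih =>
      obtain ⟨K, hK, hk⟩ := ih
      refine ⟨L * (K + 1), by nlinarith, fun t ht => ?_⟩
      have h1 := hle (2 ^ n * t) (by positivity)
      have h2 := hk t ht
      have h3 := h0 t ht
      rw [pow_succ', mul_assoc]
      calc _ ≤ L * (σ (2 ^ n * t) + 1) := h1
        _ ≤ L * (K * (σ t + 1) + 1) := by gcongr
        _ ≤ L * (K + 1) * (σ t + 1) := by nlinarith
  obtain ⟨n, hn⟩ := pow_unbounded_of_one_lt (b / a) (one_lt_two)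
  obtain ⟨K, hK, hk⟩ := hpow n
  refine ⟨K, hK, fun t ht => le_trans (hmono ?_ ?_ ?_) (hk (a * t) (by positivity))⟩
  · exact mem_Ici.2 (by positivity)
  · exact mem_Ici.2 (by positivity)
  · rw [div_lt_iff₀ ha] at hn
    rw [← mul_assoc]
    gcongr

lemma FunEquiv.symm (h : FunEquiv σ τ) : FunEquiv τ σ := ⟨h.2, h.1⟩

lemma FunEquiv.trans {ρ : ℝ → ℝ} (h : FunEquiv σ τ) (h' : FunEquiv τ ρ) : FunEquiv σ ρ :=
  ⟨h'.1.trans h.1, h.2.trans h'.2⟩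

/-- A function which agrees with a doubling `σ` up to dilations and affine changes of the values
is equivalent to `σ` and doubling. -/
lemma Om1.of_dilation_equiv (h : Om1 σ) (hmono : MonotoneOn σ (Ici 0))
    (h0 : ∀ t, 0 ≤ t → 0 ≤ σ t) (htop : Tendsto σ atTop atTop) (hτ : ∀ t, 0 ≤ t → 0 ≤ τ t)
    {a b C : ℝ} (ha : 0 < a) (hb : 0 < b) (hC : 0 ≤ C)
    (hlow : ∀ t, 0 ≤ t → σ (a * t) ≤ C * (τ t + 1))
    (hup : ∀ t, 0 ≤ t → τ t ≤ C * (σ (b * t) + 1)) :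
    FunEquiv σ τ ∧ Om1 τ := by
  obtain ⟨L, hL, hl⟩ := h.dilate hmono h0 zero_lt_one hb
  obtain ⟨K, hK, hk⟩ := h.dilate hmono h0 ha zero_lt_one
  obtain ⟨J, hJ, hj⟩ := h.dilate hmono h0 ha (mul_pos hb two_pos)
  simp only [one_mul] at hl hk
  have e1 : ∀ t, 0 ≤ t → τ t ≤ C * (L + 1) * (σ t + 1) := fun t ht => by
    have := h0 t ht
    calc τ t ≤ C * (σ (b * t) + 1) := hup t ht
      _ ≤ C * (L * (σ t + 1) + 1) := by gcongr; exact hl t ht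
      _ ≤ C * ((L + 1) * (σ t + 1)) := by gcongr; nlinarith
      _ = _ := by ring
  have e2 : ∀ t, 0 ≤ t → σ t ≤ K * (C + 1) * (τ t + 1) := fun t ht => by
    have := hτ t ht
    calc σ t ≤ K * (σ (a * t) + 1) := hk t ht
      _ ≤ K * (C * (τ t + 1) + 1) := by gcongr; exact hlow t ht
      _ ≤ K * ((C + 1) * (τ t + 1)) := by gcongr; nlinarith
      _ = _ := by ring
  have hKC : 0 < K * (C + 1) := by positivity
  have htop' : Tendsto τ atTop atTop := by
    have h1 : Tendsto (fun t => σ t / (K * (C + 1)) - 1) atTop atTop :=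
      tendsto_atTop_add_const_right _ _ (htop.atTop_div_const hKC)
    refine tendsto_atTop_mono' _ ((eventually_ge_atTop 0).mono fun t ht => ?_) h1
    have := e2 t ht
    rw [sub_le_iff_le_add, div_le_iff₀' hKC]
    exact this
  refine ⟨⟨?_, ?_⟩, ?_⟩
  · refine IsBigO.of_bound (C * (L + 1) * 2) ?_
    filter_upwards [eventually_ge_atTop 0, htop.eventually_ge_atTop 1] with t ht h1
    rw [Real.norm_of_nonneg (hτ t ht), Real.norm_of_nonneg (h0 t ht), mul_assoc _ 2]
    exact (e1 t ht).trans (by gcongr; linarith)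
  · refine IsBigO.of_bound (K * (C + 1) * 2) ?_
    filter_upwards [eventually_ge_atTop 0, htop'.eventually_ge_atTop 1] with t ht h1
    rw [Real.norm_of_nonneg (hτ t ht), Real.norm_of_nonneg (h0 t ht), mul_assoc _ 2]
    exact (e2 t ht).trans (by gcongr; linarith)
  · refine ⟨max 1 (C * (J * (C + 1) + 1)), le_max_left _ _, fun t ht => ?_⟩
    have ht' := hτ t ht
    calc τ (2 * t) ≤ C * (σ (b * (2 * t)) + 1) := hup _ (by positivity)
      _ = C * (σ (b * 2 * t) + 1) := by rw [mul_assoc]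
      _ ≤ C * (J * (σ (a * t) + 1) + 1) := by gcongr; exact hj t ht
      _ ≤ C * (J * (C * (τ t + 1) + 1) + 1) := by gcongr; exact hlow t ht
      _ ≤ C * (J * ((C + 1) * (τ t + 1)) + (τ t + 1)) := by gcongr <;> nlinarith
      _ = C * (J * (C + 1) + 1) * (τ t + 1) := by ring
      _ ≤ _ := by gcongr; exact le_max_right _ _

/-- A dilation inequality with a sufficiently large factor yields `(P̄_{σ,γ})`. -/
lemma pBar_of_dilate (htop : Tendsto σ atTop atTop) {γ A B D : ℝ} (hA : 1 < A) (hAB : A < B)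
    (h : ∀ t, 0 ≤ t → B * σ t ≤ σ (A ^ γ * t) + D) : PBar σ γ := by
  refine ⟨A, hA, ?_⟩
  -- The gap `B - E` absorbs `D` once `σ t` is large, and `E > A` keeps the lower limit strictly
  -- above `A`.
  obtain ⟨E, hAE, hEB⟩ := exists_between hAB
  refine lt_of_lt_of_le (EReal.coe_lt_coe_iff.2 hAE) (le_liminf_of_le (by isBoundedDefault) ?_)
  filter_upwards [eventually_ge_atTop 0, htop.eventually_ge_atTop (|D| / (B - E)),
    htop.eventually_gt_atTop 0] with t ht h1 h2
  rw [EReal.coe_le_coe_iff, le_div_iff₀ h2]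
  rw [div_le_iff₀ (sub_pos.2 hEB)] at h1
  linarith [h t ht, le_abs_self D]

lemma gammaBar_le_of_pBar {γ : ℝ} (hγ : 0 < γ) (h : PBar σ γ) : gammaBar σ ≤ (γ : EReal) :=
  sInf_le ⟨γ, ⟨hγ, h⟩, rfl⟩

/-- Take `A = 3Q/2`, strictly between `Q` and `2Q`. The exponent with `A ^ γ = Q` is then less than
`1`. -/
lemma gammaBar_lt_one_of_dilate (htop : Tendsto σ atTop atTop) {Q D : ℝ} (hQ : 1 < Q)
    (h : ∀ t, 0 ≤ t → 2 * Q * σ t ≤ σ (Q * t) + D) : gammaBar σ < 1 := by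
  have hlQ := Real.log_pos hQ
  have hl : Real.log Q < Real.log (3 / 2 * Q) := Real.log_lt_log (by linarith) (by linarith)
  have hγ : Real.log Q / Real.log (3 / 2 * Q) < 1 := (div_lt_one (hlQ.trans hl)).2 hl
  have hpow : (3 / 2 * Q) ^ (Real.log Q / Real.log (3 / 2 * Q)) = Q := by
    rw [Real.rpow_def_of_pos (by linarith), mul_div_cancel₀ _ (hlQ.trans hl).ne',
      Real.exp_log (by linarith)]
  refine lt_of_le_of_lt (gammaBar_le_of_pBar (div_pos hlQ (hlQ.trans hl))
    (pBar_of_dilate htop (A := 3 / 2 * Q) (B := 2 * Q) (D := D) (by linarith) (by linarith)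
      fun t ht => ?_)) (by exact_mod_cast hγ)
  rw [hpow]
  exact h t ht

/-- For `γ < 1` the dilation `B = A ^ γ` is smaller than the gain `A`. Iterating `n` times makes the
ratio `(A / B) ^ n` exceed `2`, and then `Q = B ^ n`. -/
lemma exists_dilate_of_gammaBar_lt_one (hmono : MonotoneOn σ (Ici 0)) (h0 : ∀ t, 0 ≤ t → 0 ≤ σ t)
    (htop : Tendsto σ atTop atTop) (h : gammaBar σ < 1) :
    ∃ Q D : ℝ, 1 < Q ∧ 0 ≤ D ∧ ∀ t, 0 ≤ t → 2 * Q * σ t ≤ σ (Q * t) + D := by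
  obtain ⟨_, ⟨γ, ⟨hγ0, A, hA, hlim⟩, rfl⟩, hγ1⟩ := sInf_lt_iff.1 h
  replace hγ1 : γ < 1 := EReal.coe_lt_coe_iff.1 hγ1
  set B : ℝ := A ^ γ with hB
  have hA0 : 0 < A := by linarith
  have hB1 : 1 < B := Real.one_lt_rpow hA hγ0
  have hBA : B < A := by simpa using Real.rpow_lt_rpow_of_exponent_lt hA hγ1
  obtain ⟨T, hT⟩ := eventually_atTop.1
    ((eventually_lt_of_lt_liminf hlim).and (htop.eventually_gt_atTop 0))
  -- The additive constant handles `t ≤ T`, where the liminf gives no information.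
  have step : ∀ t, 0 ≤ t → A * σ t ≤ σ (B * t) + A * σ (max T 0) := fun t ht => by
    have hn := h0 _ (mul_nonneg (zero_le_one.trans hB1.le) ht)
    rcases le_total T t with h1 | h1
    · obtain ⟨h2, h3⟩ := hT t h1
      rw [EReal.coe_lt_coe_iff, lt_div_iff₀ h3] at h2
      have := mul_nonneg hA0.le (h0 _ (le_max_right T 0))
      linarith
    · have := mul_le_mul_of_nonneg_left
        (hmono ht (le_max_right T 0) (h1.trans (le_max_left T 0))) hA0.le
      linarith
  have iter : ∀ n : ℕ, ∃ D, 0 ≤ D ∧ ∀ t, 0 ≤ t → A ^ n * σ t ≤ σ (B ^ n * t) + D := by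
    intro n
    induction n with
    | zero => exact ⟨0, le_rfl, fun t _ => by simp⟩
    | succ n ih =>
      obtain ⟨D, hD, hd⟩ := ih
      refine ⟨A * σ (max T 0) + A * D, ?_, fun t ht => ?_⟩
      · have := h0 _ (le_max_right T 0)
        positivity
      · have h1 := step (B ^ n * t) (by positivity)
        have h2 := mul_le_mul_of_nonneg_left (hd t ht) hA0.le
        rw [pow_succ', pow_succ', mul_assoc B, mul_assoc A]
        linarith
  obtain ⟨n, hn⟩ := pow_unbounded_of_one_lt 2 ((one_lt_div (by linarith : 0 < B)).2 hBA)
  have hn0 : n ≠ 0 := by rintro rfl; norm_num at hn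
  obtain ⟨D, hD, hd⟩ := iter n
  refine ⟨B ^ n, D, one_lt_pow₀ hB1 hn0, hD, fun t ht => le_trans ?_ (hd t ht)⟩
  rw [div_pow, lt_div_iff₀ (by positivity)] at hn
  exact mul_le_mul_of_nonneg_right hn.le (h0 t ht)

lemma om6_of_dilate (hmono : MonotoneOn σ (Ici 0)) {Q D : ℝ} (hQ : 0 ≤ Q)
    (h : ∀ t, 0 ≤ t → 2 * σ t ≤ σ (Q * t) + D) : Om6 σ := by
  refine ⟨max 1 (max Q D), le_max_left _ _, fun t ht => (h t ht).trans (add_le_add (hmono ?_ ?_ ?_) ?_)⟩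
  · exact mem_Ici.2 (by positivity)
  · exact mem_Ici.2 (by positivity)
  · gcongr; exact (le_max_left Q D).trans (le_max_right _ _)
  · exact (le_max_right Q D).trans (le_max_right _ _)

/-- A dilation inequality for `σ` makes the conjugate doubling. -/
lemma ConjWellDefined.om1_conj (hσ : ConjWellDefined σ) (h1 : σ 1 = 0) {Q D : ℝ} (hQ : 1 < Q)
    (hD : 0 ≤ D) (h : ∀ t, 0 ≤ t → 2 * Q * σ t ≤ σ (Q * t) + D) : Om1 (conj σ) := by
  refine ⟨2 * Q + D, by linarith, fun s hs => ?_⟩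
  have hc := hs.trans (hσ.self_le_conj h1 hs)
  refine (conj_le (B := 2 * Q * conj σ s + D) fun u hu => ?_).trans (by nlinarith)
  have hQ0 : 0 < Q := by linarith
  -- At `u / Q` the factor `2 * Q` turns `s * (u / Q)` into `2 * s * u`, the linear term of the
  -- conjugate at `2 * s`.
  have h2 := h (u / Q) (by positivity)
  rw [mul_div_cancel₀ _ hQ0.ne'] at h2
  have h3 := mul_le_mul_of_nonneg_left (hσ.le_conj hs (div_nonneg hu hQ0.le))
    (by positivity : 0 ≤ 2 * Q)
  have : 2 * Q * (s * (u / Q) - σ (u / Q)) = 2 * s * u - 2 * Q * σ (u / Q) := by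
    field_simp
  linarith

/-- The conjugate of a doubling function satisfies a dilation inequality. -/
lemma Om1.exists_dilate_conj (h : Om1 σ) (h0 : ∀ t, 0 ≤ t → 0 ≤ σ t) (hσ : ConjWellDefined σ) :
    ∃ Q D : ℝ, 1 < Q ∧ ∀ s, 0 ≤ s → 2 * Q * conj σ s ≤ conj σ (Q * s) + D := by
  obtain ⟨L, hL, hle⟩ := h
  -- Testing the conjugate at `2 * u` makes the linear terms agree for any `Q`. It remains that `L *
  -- (σ u + 1) ≤ 2 * Q * σ u + D`, which these values satisfy with room to spare.
  refine ⟨2 * L, 4 * L, by linarith, fun s hs => ?_⟩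
  rw [← le_div_iff₀' (by positivity)]
  refine conj_le fun u hu => ?_
  rw [le_div_iff₀' (by positivity)]
  have h1 := hσ.le_conj (mul_nonneg (by linarith : 0 ≤ 2 * L) hs) (mul_nonneg two_pos.le hu)
  have h2 := hle u hu
  have h3 := mul_nonneg (zero_le_one.trans hL) (h0 u hu)
  linarith

end Dilation

/-! ### Comparison of sequences in logarithmic form -/

section Sequences

variable {M N : ℕ → ℝ}

/-- In logarithms, equivalence of sequences is an `O(p)` perturbation; all comparisons below use
this form. -/
lemma seqPreceq_iff (hM : ∀ p, 0 < M p) (hN : ∀ p, 0 < N p) :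
    SeqPreceq M N ↔ ∃ c : ℝ, ∀ p : ℕ, 1 ≤ p → Real.log (M p) ≤ Real.log (N p) + c * p := by
  have key : ∀ p : ℕ, 1 ≤ p → ∀ B : ℝ, 0 < B →
      ((M p / N p) ^ (1 / (p : ℝ)) ≤ B ↔ Real.log (M p) ≤ Real.log (N p) + Real.log B * p) := by
    intro p hp B hB
    have hp0 : (0 : ℝ) < p := by exact_mod_cast hp
    have hq : 0 < M p / N p := div_pos (hM p) (hN p)
    rw [← Real.log_le_log_iff (Real.rpow_pos_of_pos hq _) hB, Real.log_rpow hq,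
      Real.log_div (hM p).ne' (hN p).ne', one_div, inv_mul_le_iff₀ hp0]
    constructor <;> intro h <;> linarith
  constructor
  · rintro ⟨B, hB⟩
    refine ⟨Real.log (max B 1), fun p hp => (key p hp _ (by positivity)).1 ?_⟩
    exact (hB (mem_image_of_mem _ (mem_Ici.2 hp))).trans (le_max_left _ _)
  · rintro ⟨c, hc⟩
    refine ⟨Real.exp c, ?_⟩
    rintro _ ⟨p, hp, rfl⟩
    refine (key p hp _ (Real.exp_pos c)).2 ?_
    rw [Real.log_exp]
    exact hc p hp

lemma seqConj_pos (hM : ∀ p, 0 < M p) (p : ℕ) : 0 < seqConj M p :=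
  div_pos (by exact_mod_cast p.factorial_pos) (hM p)

lemma log_seqConj (hM : ∀ p, 0 < M p) (p : ℕ) :
    Real.log (seqConj M p) = Real.log (p.factorial : ℝ) - Real.log (M p) :=
  Real.log_div (by exact_mod_cast p.factorial_ne_zero) (hM p).ne'

lemma SeqPreceq.seqConj (hM : ∀ p, 0 < M p) (hN : ∀ p, 0 < N p) (h : SeqPreceq M N) :
    SeqPreceq (seqConj N) (seqConj M) := by
  obtain ⟨c, hc⟩ := (seqPreceq_iff hM hN).1 h
  refine (seqPreceq_iff (seqConj_pos hN) (seqConj_pos hM)).2 ⟨c, fun p hp => ?_⟩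
  rw [log_seqConj hM, log_seqConj hN]
  linarith [hc p hp]

lemma SeqEquiv.seqConj (hM : ∀ p, 0 < M p) (hN : ∀ p, 0 < N p) (h : SeqEquiv M N) :
    SeqEquiv (seqConj M) (seqConj N) :=
  ⟨h.2.seqConj hN hM, h.1.seqConj hM hN⟩

lemma assoc_le {t B : ℝ} (h : ∀ p : ℕ, Real.log (M 0 * t ^ p / M p) ≤ B) : assoc M t ≤ B :=
  ciSup_le h

lemma AssocWellDefined.le_assoc (h : AssocWellDefined M) {t : ℝ} (ht : 0 ≤ t) (p : ℕ) :
    Real.log (M 0 * t ^ p / M p) ≤ assoc M t :=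
  le_ciSup (h t ht) p

lemma AssocWellDefined.assoc_nonneg (h : AssocWellDefined M) (h0 : 0 < M 0) {t : ℝ} (ht : 0 ≤ t) :
    0 ≤ assoc M t := by
  have := h.le_assoc ht 0
  rwa [pow_zero, mul_one, div_self h0.ne', Real.log_one] at this

lemma log_term (h0 : M 0 = 1) (hM : ∀ p, 0 < M p) {t : ℝ} (ht : 0 < t) (p : ℕ) :
    Real.log (M 0 * t ^ p / M p) = p * Real.log t - Real.log (M p) := by
  rw [h0, one_mul, Real.log_div (pow_pos ht p).ne' (hM p).ne', Real.log_pow]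

lemma log_term_zero (h0 : M 0 = 1) (p : ℕ) : Real.log (M 0 * (0 : ℝ) ^ p / M p) = 0 := by
  rcases p with _ | p <;> simp [h0]

lemma log_factorial_le (p : ℕ) : Real.log (p.factorial : ℝ) ≤ p * Real.log p := by
  rw [← Real.log_pow]
  refine Real.log_le_log (by exact_mod_cast p.factorial_pos) ?_
  exact_mod_cast p.factorial_le_pow

/-- This is `u^p / p! ≤ exp u`. The choice `u = p` gives the lower Stirling bound, while a free `u`
links factorials to `ω*`. -/
lemma mul_log_sub_le_log_factorial {u : ℝ} (hu : 0 < u) (p : ℕ) :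
    p * Real.log u - u ≤ Real.log (p.factorial : ℝ) := by
  have hf : (0 : ℝ) < p.factorial := by exact_mod_cast p.factorial_pos
  have h := Real.log_le_log (div_pos (pow_pos hu p) hf) (Real.pow_div_factorial_le_exp u hu.le p)
  rw [Real.log_exp, Real.log_div (pow_pos hu p).ne' hf.ne', Real.log_pow] at h
  linarith

/-- If all terms were smaller, weighting them by `2⁻ᵖ` and summing would give `exp(x/2) ≤
exp(x/2)/2`. -/
lemma exists_exp_half_le (x : ℝ) :
    ∃ p : ℕ, Real.exp (x / 2) / 4 ≤ x ^ p / (p.factorial : ℝ) := by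
  by_contra! h
  have h1 : HasSum (fun n : ℕ => (x / 2) ^ n / (n.factorial : ℝ)) (Real.exp (x / 2)) := by
    rw [Real.exp_eq_exp_ℝ]
    exact NormedSpace.expSeries_div_hasSum_exp (x / 2)
  have h2 := hasSum_geometric_two.mul_left (Real.exp (x / 2) / 4)
  have h3 := hasSum_le (fun n => ?_) h1 h2
  · linarith [Real.exp_pos (x / 2)]
  · rw [div_pow, div_right_comm, one_div, inv_pow, ← div_eq_mul_inv]
    exact div_le_div_of_nonneg_right (h n).le (by positivity)

end Sequences

/-! ### The associated weight matrix -/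

section Matrix

variable {ω : ℝ → ℝ} {l : ℝ}

lemma matrixW_pos (p : ℕ) : 0 < matrixW ω l p := Real.exp_pos _

lemma log_matrixW (p : ℕ) : Real.log (matrixW ω l p) = 1 / l * young ω (l * p) := Real.log_exp _

lemma InW0.matrixW_zero (hω : InW0 ω) : matrixW ω l 0 = 1 := by
  simp [matrixW, hω.young_zero]

lemma InW0.seqConj_matrixW_zero (hω : InW0 ω) : seqConj (matrixW ω l) 0 = 1 := by
  simp [seqConj, hω.matrixW_zero]

lemma InW0.log_term_matrixW_le (hω : InW0 ω) (hl : 0 < l) {t : ℝ} (ht : 0 ≤ t) (p : ℕ) :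
    Real.log (matrixW ω l 0 * t ^ p / matrixW ω l p) ≤ 1 / l * ω t := by
  rcases ht.eq_or_lt with rfl | ht
  · rw [log_term_zero hω.matrixW_zero]
    exact mul_nonneg (by positivity) (hω.nonneg le_rfl)
  · rw [log_term hω.matrixW_zero matrixW_pos ht, log_matrixW]
    have := hω.le_young (x := l * p) (by positivity) (Real.log t)
    rw [Real.exp_log ht] at this
    have e : (p : ℝ) * Real.log t - 1 / l * young ω (l * p) =
        1 / l * (l * p * Real.log t - young ω (l * p)) := by field_simp
    rw [e]
    gcongr
    linarith

lemma InW0.assocWellDefined_matrixW (hω : InW0 ω) (hl : 0 < l) :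
    AssocWellDefined (matrixW ω l) := by
  intro t ht
  refine ⟨1 / l * ω t, ?_⟩
  rintro _ ⟨p, rfl⟩
  exact hω.log_term_matrixW_le hl ht p

lemma InW0.mul_assoc_matrixW_le (hω : InW0 ω) (hl : 0 < l) {t : ℝ} (ht : 0 ≤ t) :
    l * assoc (matrixW ω l) t ≤ ω t := by
  rw [← le_div_iff₀' hl, div_eq_inv_mul, ← one_div]
  exact assoc_le (hω.log_term_matrixW_le hl ht)

/-- The maximizer `x` in the biconjugate is real, whereas the associated function sees only the
points `l * p`. Rounding down costs at most `l * log t`, which is at most `ω t / 2` plus a constant;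
hence the factor `2`. -/
lemma InW0.exists_le_assoc_matrixW (hω : InW0 ω) (hl : 0 < l) :
    ∃ D : ℝ, 1 ≤ D ∧ ∀ t, 0 ≤ t → ω t ≤ 2 * l * assoc (matrixW ω l) t + D := by
  obtain ⟨D, hD, hlog⟩ := hω.log_le (c := 1 / (2 * l)) (by positivity)
  refine ⟨1 + 2 * l * D, le_add_of_nonneg_right (by positivity), fun t ht => ?_⟩
  have hwd := hω.assocWellDefined_matrixW hl
  have hnn := hwd.assoc_nonneg (matrixW_pos 0) ht
  rcases le_total t 1 with h1 | h1
  · rw [hω.eq_zero t ⟨ht, h1⟩]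
    positivity
  · have ht0 : 0 < t := by linarith
    have hy : 0 ≤ Real.log t := Real.log_nonneg h1
    obtain ⟨x, hx, hxy⟩ := hω.exists_young_eq (Real.log t)
    rw [Real.exp_log ht0] at hxy
    set p := ⌊x / l⌋₊ with hp
    have hp1 : l * p ≤ x := by
      rw [← le_div_iff₀' hl]; exact Nat.floor_le (by positivity)
    have hp2 : x ≤ l * (p + 1) := by
      rw [← div_le_iff₀' hl]; exact (Nat.lt_floor_add_one _).le
    have h3 := hwd.le_assoc ht p
    rw [log_term hω.matrixW_zero matrixW_pos ht0, log_matrixW] at h3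
    have h4 := hω.young_mono (by positivity) hp1
    have h5 : l * p * Real.log t - young ω (l * p) ≤ l * assoc (matrixW ω l) t := by
      have := mul_le_mul_of_nonneg_left h3 hl.le
      have e : l * ((p : ℝ) * Real.log t - 1 / l * young ω (l * p)) =
        l * p * Real.log t - young ω (l * p) := by field_simp
      linarith
    have h6 := mul_le_mul_of_nonneg_right hp2 hy
    have h7 := mul_le_mul_of_nonneg_left (hlog t h1) (by positivity : 0 ≤ 2 * l)
    have h8 : 2 * l * (1 / (2 * l) * ω t + D) = ω t + 2 * l * D := by field_simp
    linarith

lemma sub_assoc_matrixW_le {D : ℝ} (hl : 0 < l)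
    (hC : ConjWellDefined ω) (h : ∀ t, 0 ≤ t → ω t ≤ 2 * l * assoc (matrixW ω l) t + D)
    {s t : ℝ} (hs : 0 ≤ s) (ht : 0 ≤ t) :
    s * t - assoc (matrixW ω l) t ≤ 1 / (2 * l) * conj ω (2 * l * s) + D / (2 * l) := by
  have h1 := hC.le_conj (s := 2 * l * s) (by positivity) ht
  have h2 := h t ht
  rw [one_div_mul_eq_div, ← add_div, le_div_iff₀ (by positivity)]
  linarith

lemma InW0.conjWellDefined_assoc_matrixW (hω : InW0 ω) (hC : ConjWellDefined ω) (hl : 0 < l) :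
    ConjWellDefined (assoc (matrixW ω l)) := by
  obtain ⟨D, -, hD⟩ := hω.exists_le_assoc_matrixW hl
  intro s hs
  refine ⟨1 / (2 * l) * conj ω (2 * l * s) + D / (2 * l), ?_⟩
  rintro _ ⟨t, ht, rfl⟩
  exact sub_assoc_matrixW_le hl hC hD hs ht

lemma InW0.conj_le_conj_assoc_matrixW (hω : InW0 ω) (hC : ConjWellDefined ω) (hl : 0 < l) {s : ℝ}
    (hs : 0 ≤ s) : 1 / l * conj ω (s * l) ≤ conj (assoc (matrixW ω l)) s := by
  rw [one_div_mul_eq_div, div_le_iff₀ hl]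
  refine conj_le fun t ht => ?_
  have h1 := (hω.conjWellDefined_assoc_matrixW hC hl).le_conj hs ht
  have h2 := mul_le_mul_of_nonneg_left h1 hl.le
  have h3 := hω.mul_assoc_matrixW_le hl ht
  linarith

/-! ### The associated function of the conjugate sequence -/

/-- The bound `u^p / p! ≤ exp u` at `u = t * exp y` dominates each term of `φ*(lp)` by a term of
`ω*(lt)`, up to the factorial correction. -/
lemma InW0.log_term_seqConj_le (hω : InW0 ω) (hC : ConjWellDefined ω) (hl : 0 < l) {t : ℝ}
    (ht : 0 ≤ t) (p : ℕ) :
    Real.log (seqConj (matrixW ω l) 0 * t ^ p / seqConj (matrixW ω l) p)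
      ≤ 1 / l * conj ω (l * t) := by
  rcases ht.eq_or_lt with rfl | ht
  · rw [log_term_zero hω.seqConj_matrixW_zero, mul_zero]
    have := hC.le_conj le_rfl (le_refl (0 : ℝ))
    rw [hω.eq_zero 0 ⟨le_rfl, zero_le_one⟩] at this
    have h0 : 0 ≤ conj ω 0 := by linarith
    positivity
  · rw [log_term hω.seqConj_matrixW_zero (seqConj_pos matrixW_pos) ht, log_seqConj matrixW_pos,
      log_matrixW]
    have h1 : young ω (l * p) ≤
        conj ω (l * t) + l * (Real.log (p.factorial : ℝ) - p * Real.log t) := young_le fun y _ => by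
      have h2 := hC.le_conj (s := l * t) (by positivity) (Real.exp_pos y).le
      have h3 := mul_log_sub_le_log_factorial (mul_pos ht (Real.exp_pos y)) p
      rw [Real.log_mul ht.ne' (Real.exp_pos y).ne', Real.log_exp] at h3
      have := mul_le_mul_of_nonneg_left h3 hl.le
      linarith
    have h4 := mul_le_mul_of_nonneg_left h1 (by positivity : 0 ≤ 1 / l)
    have e : 1 / l * (conj ω (l * t) + l * (Real.log (p.factorial : ℝ) - p * Real.log t)) =
      1 / l * conj ω (l * t) + (Real.log (p.factorial : ℝ) - p * Real.log t) := by field_simp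
    linarith

lemma InW0.assocWellDefined_seqConj (hω : InW0 ω) (hC : ConjWellDefined ω) (hl : 0 < l) :
    AssocWellDefined (seqConj (matrixW ω l)) := by
  intro t ht
  refine ⟨1 / l * conj ω (l * t), ?_⟩
  rintro _ ⟨p, rfl⟩
  exact hω.log_term_seqConj_le hC hl ht p

lemma InW0.assoc_seqConj_le (hω : InW0 ω) (hC : ConjWellDefined ω) (hl : 0 < l) {t : ℝ}
    (ht : 0 ≤ t) : assoc (seqConj (matrixW ω l)) t ≤ 1 / l * conj ω (l * t) :=
  assoc_le (hω.log_term_seqConj_le hC hl ht)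

/-- For each `u`, choose `p` with `(tu)^p / p! ≥ exp(tu/2)/4`. The half in the exponent becomes the
dilation `l / 2`, and the factor `1/4` becomes `log 4`. -/
lemma InW0.conj_le_assoc_seqConj (hω : InW0 ω) (hC : ConjWellDefined ω) (hl : 0 < l) {t : ℝ}
    (ht : 0 ≤ t) :
    conj ω (l / 2 * t) ≤ l * (assoc (seqConj (matrixW ω l)) t + Real.log 4) := by
  have hwd := hω.assocWellDefined_seqConj hC hl
  have hnn := hwd.assoc_nonneg (seqConj_pos matrixW_pos 0) ht
  have hlog4 : 0 ≤ Real.log 4 := Real.log_nonneg (by norm_num)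
  refine conj_le fun u hu => ?_
  rcases ht.eq_or_lt with rfl | ht0
  · have := hω.nonneg hu
    have : 0 ≤ l * (assoc (seqConj (matrixW ω l)) 0 + Real.log 4) := by positivity
    linarith
  rcases hu.eq_or_lt with rfl | hu0
  · have := hω.nonneg hu
    have : 0 ≤ l * (assoc (seqConj (matrixW ω l)) t + Real.log 4) := by positivity
    linarith
  obtain ⟨p, hp⟩ := exists_exp_half_le (t * u)
  have h1 := Real.log_le_log (by positivity) hp
  rw [Real.log_div (Real.exp_pos _).ne' (by norm_num), Real.log_exp,
    Real.log_div (by positivity) (by positivity), Real.log_pow,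
    Real.log_mul ht0.ne' hu0.ne'] at h1
  have h2 := hwd.le_assoc ht p
  rw [log_term hω.seqConj_matrixW_zero (seqConj_pos matrixW_pos) ht0, log_seqConj matrixW_pos,
    log_matrixW] at h2
  have h3 := hω.le_young (x := l * p) (by positivity) (Real.log u)
  rw [Real.exp_log hu0] at h3
  have h4 := mul_le_mul_of_nonneg_left h1 hl.le
  have h5 := mul_le_mul_of_nonneg_left h2 hl.le
  have e : l * (1 / l * young ω (l * p)) = young ω (l * p) := by field_simp
  linarith

/-! ### Consequences of dilation inequalities for the matrix -/

lemma Om6.exists_young_two_mul_le (hω : InW0 ω) (h : Om6 ω) :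
    ∃ c D : ℝ, 0 ≤ c ∧ 0 ≤ D ∧ ∀ x, 0 ≤ x → young ω (2 * x) ≤ 2 * young ω x + c * x + D := by
  obtain ⟨H, hH, hle⟩ := h
  refine ⟨2 * Real.log H, H, mul_nonneg two_pos.le (Real.log_nonneg hH), by linarith,
    fun x hx => ?_⟩
  have := hω.young_dilate one_le_two (by linarith : 0 < H) hle hx
  linarith

/-- Iterated doubling bounds the growth of `φ*(x)/x` from `x` to `2 ^ n * x`; its monotonicity then
covers any `l₁ ≤ 2 ^ n * l₂`. -/
lemma seqPreceq_matrixW (hω : InW0 ω)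
    (h : ∃ c D : ℝ, 0 ≤ c ∧ 0 ≤ D ∧ ∀ x, 0 ≤ x → young ω (2 * x) ≤ 2 * young ω x + c * x + D)
    {l₁ l₂ : ℝ} (h1 : 0 < l₁) (h2 : 0 < l₂) : SeqPreceq (matrixW ω l₁) (matrixW ω l₂) := by
  obtain ⟨c, D, hc, hD, hle⟩ := h
  have iter : ∀ n : ℕ, ∃ c D : ℝ, 0 ≤ c ∧ 0 ≤ D ∧
      ∀ x, 0 ≤ x → young ω (2 ^ n * x) ≤ 2 ^ n * young ω x + c * x + D := by
    intro n
    induction n with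
    | zero => exact ⟨0, 0, le_rfl, le_rfl, fun x _ => by simp⟩
    | succ n ih =>
      obtain ⟨c', D', hc', hD', hle'⟩ := ih
      refine ⟨2 * c' + c * 2 ^ n, 2 * D' + D, by positivity, by positivity, fun x hx => ?_⟩
      have h3 := hle (2 ^ n * x) (by positivity)
      have h4 := hle' x hx
      rw [pow_succ', mul_assoc]
      linarith
  obtain ⟨n, hn⟩ := pow_unbounded_of_one_lt (max 1 (l₁ / l₂)) one_lt_two
  obtain ⟨c', D', hc', hD', hle'⟩ := iter n
  have hn1 : l₁ ≤ 2 ^ n * l₂ := by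
    rw [← div_le_iff₀ h2]; exact (le_max_right _ _).trans hn.le
  refine (seqPreceq_iff matrixW_pos matrixW_pos).2 ⟨c' + D' / l₂, fun p hp => ?_⟩
  have hp1 : (1 : ℝ) ≤ p := by exact_mod_cast hp
  have hp0 : (0 : ℝ) < p := by linarith
  have h3 := hω.young_div_le (x := l₁ * p) (x' := 2 ^ n * (l₂ * p)) (by positivity)
    (by rw [← mul_assoc]; gcongr)
  have h4 := hle' (l₂ * p) (by positivity)
  rw [log_matrixW, log_matrixW]
  calc 1 / l₁ * young ω (l₁ * p) = young ω (l₁ * p) / (l₁ * p) * p := by field_simp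
    _ ≤ young ω (2 ^ n * (l₂ * p)) / (2 ^ n * (l₂ * p)) * p := by gcongr
    _ ≤ (2 ^ n * young ω (l₂ * p) + c' * (l₂ * p) + D') / (2 ^ n * (l₂ * p)) * p := by gcongr
    _ = 1 / l₂ * young ω (l₂ * p) + (c' * p + D' / l₂) / 2 ^ n := by field_simp; try ring
    _ ≤ 1 / l₂ * young ω (l₂ * p) + (c' * p + D' / l₂) := by
        gcongr
        exact div_le_self (by positivity) (one_le_pow₀ one_le_two)
    _ ≤ 1 / l₂ * young ω (l₂ * p) + (c' * p + D' / l₂ * p) := by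
        gcongr
        exact le_mul_of_one_le_right (by positivity) hp1
    _ = _ := by ring

lemma Om6.constantMatrix (hω : InW0 ω) (h : Om6 ω) : ConstantMatrix (matrixW ω) :=
  fun _ _ h1 h2 => ⟨seqPreceq_matrixW hω (h.exists_young_two_mul_le hω) h1 h2,
    seqPreceq_matrixW hω (h.exists_young_two_mul_le hω) h2 h1⟩

lemma Om6.constantMatrix_conj (hω : InW0 ω) (h : Om6 ω) : ConstantMatrix (matrixWConj ω) :=
  fun _ _ h1 h2 => (h.constantMatrix hω _ _ (one_div_pos.2 h1) (one_div_pos.2 h2)).seqConj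
    matrixW_pos matrixW_pos

lemma moderateGrowth_of_log {M : ℕ → ℝ} (hM : ∀ p, 0 < M p) {c : ℝ} (hc : 0 ≤ c)
    (h : ∀ p q : ℕ, Real.log (M (p + q)) ≤
      Real.log (M p) + Real.log (M q) + c * ((p : ℝ) + q + 1)) : ModerateGrowth M := by
  refine ⟨Real.exp c, Real.one_le_exp hc, fun p q => ?_⟩
  have hE := pow_pos (Real.exp_pos c) (p + q + 1)
  rw [← Real.log_le_log_iff (hM _) (mul_pos (mul_pos hE (hM p)) (hM q)),
    Real.log_mul (mul_pos hE (hM p)).ne' (hM q).ne', Real.log_mul hE.ne' (hM p).ne',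
    Real.log_pow, Real.log_exp]
  push_cast
  linarith [h p q]

/-- Midpoint convexity at `2lp` and `2lq` bounds `φ*(l(p+q))`, and the doubling estimate removes the
factors `2`. -/
lemma Om6.moderateGrowth (hω : InW0 ω) (h : Om6 ω) (hl : 0 < l) :
    ModerateGrowth (matrixW ω l) := by
  obtain ⟨c, D, hc, hD, hle⟩ := h.exists_young_two_mul_le hω
  refine moderateGrowth_of_log matrixW_pos (c := c + D / l) (by positivity) fun p q => ?_
  rw [log_matrixW, log_matrixW, log_matrixW]
  have h1 := hω.young_midpoint (x := 2 * (l * p)) (x' := 2 * (l * q)) (by positivity)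
    (by positivity)
  have h2 := hle (l * p) (by positivity)
  have h3 := hle (l * q) (by positivity)
  have e1 : (2 * (l * p) + 2 * (l * q)) / 2 = l * ((p + q : ℕ) : ℝ) := by push_cast; ring
  rw [e1] at h1
  have h4 : young ω (l * ((p + q : ℕ) : ℝ)) ≤
      young ω (l * p) + young ω (l * q) + c * (l * (p + q)) + D := by
    have : 0 ≤ c * (l * ((p : ℝ) + q)) := by positivity
    linarith
  have h5 := mul_le_mul_of_nonneg_left h4 (by positivity : 0 ≤ 1 / l)
  have e2 : 1 / l * (young ω (l * p) + young ω (l * q) + c * (l * (p + q)) + D) =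
    1 / l * young ω (l * p) + 1 / l * young ω (l * q) + c * (p + q) + D / l := by field_simp
  have h6 : 0 ≤ D / l * ((p : ℝ) + q) := by positivity
  linarith

/-- Superadditivity of `φ*` gives `W_p W_q ≤ W_{p+q}`, and the binomial coefficient is at most
`2^(p+q)`. -/
lemma InW0.moderateGrowth_seqConj (hω : InW0 ω) (hl : 0 < l) :
    ModerateGrowth (seqConj (matrixW ω l)) := by
  have hl2 : 0 ≤ Real.log 2 := Real.log_nonneg one_le_two
  refine moderateGrowth_of_log (seqConj_pos matrixW_pos) hl2 fun p q => ?_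
  rw [log_seqConj matrixW_pos, log_seqConj matrixW_pos, log_seqConj matrixW_pos,
    log_matrixW, log_matrixW, log_matrixW]
  have h1 := hω.young_superadd (x := l * p) (x' := l * q) (by positivity) (by positivity)
  rw [← mul_add] at h1
  have h2 := mul_le_mul_of_nonneg_left h1 (by positivity : 0 ≤ 1 / l)
  have h3 : ((p + q).factorial : ℝ) ≤ 2 ^ (p + q) * p.factorial * q.factorial := by
    rw [← Nat.add_choose_mul_factorial_mul_factorial p q]
    exact_mod_cast Nat.mul_le_mul_right _ (Nat.mul_le_mul_right _ (Nat.choose_le_two_pow _ _))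
  have hp : (0 : ℝ) < p.factorial := by exact_mod_cast p.factorial_pos
  have hq : (0 : ℝ) < q.factorial := by exact_mod_cast q.factorial_pos
  have h4 := Real.log_le_log (by exact_mod_cast (p + q).factorial_pos) h3
  rw [Real.log_mul (by positivity) hq.ne', Real.log_mul (by positivity) hp.ne',
    Real.log_pow] at h4
  push_cast at h4 ⊢
  linarith

end Matrix

/-! ### Almost decreasing roots -/

/-- `p ↦ (N_p)^{1/p} / p` is almost decreasing, in logarithmic form. -/
def RootAlmostDecreasing (N : ℕ → ℝ) : Prop :=
  ∃ C : ℝ, ∀ p q : ℕ, 1 ≤ p → p ≤ q →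
    Real.log (N q) / q ≤ Real.log (N p) / p + (Real.log q - Real.log p) + C

section Roots

variable {M N : ℕ → ℝ}

lemma RootAlmostDecreasing.congr (hM : ∀ p, 0 < M p) (hN : ∀ p, 0 < N p) (h : SeqEquiv M N)
    (hr : RootAlmostDecreasing M) : RootAlmostDecreasing N := by
  obtain ⟨c, hc⟩ := (seqPreceq_iff hM hN).1 h.1
  obtain ⟨d, hd⟩ := (seqPreceq_iff hN hM).1 h.2
  obtain ⟨C, hC⟩ := hr
  refine ⟨C + c + d, fun p q hp hpq => ?_⟩
  have hp0 : (0 : ℝ) < p := by exact_mod_cast hp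
  have hq0 : (0 : ℝ) < q := by exact_mod_cast hp.trans hpq
  have h1 : Real.log (N q) / q ≤ Real.log (M q) / q + d := by
    rw [div_add' _ _ _ hq0.ne']
    exact div_le_div_of_nonneg_right (hd q (hp.trans hpq)) hq0.le
  have h2 : Real.log (M p) / p ≤ Real.log (N p) / p + c := by
    rw [div_add' _ _ _ hp0.ne']
    exact div_le_div_of_nonneg_right (hc p hp) hp0.le
  linarith [hC p q hp hpq]

/-- The root `(p!)^{1/p}` lies between `p/e` and `p`, so replacing it by `p` costs the constant `1`
in logarithms. -/
lemma rootAlmostDecreasing_of_antitone (hN : ∀ p, 0 < N p)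
    (h : AntitoneOn (fun p : ℕ => (small N p) ^ (1 / (p : ℝ))) (Ici 1)) :
    RootAlmostDecreasing N := by
  refine ⟨1, fun p q hp hpq => ?_⟩
  have hp0 : (0 : ℝ) < p := by exact_mod_cast hp
  have hq0 : (0 : ℝ) < q := by exact_mod_cast hp.trans hpq
  have hf : ∀ n : ℕ, (0 : ℝ) < n.factorial := fun n => by exact_mod_cast n.factorial_pos
  have hs : ∀ n, 0 < small N n := fun n => div_pos (hN n) (hf n)
  have hlog : ∀ n : ℕ, Real.log ((small N n) ^ (1 / (n : ℝ))) =
      Real.log (N n) / n - Real.log (n.factorial : ℝ) / n := fun n => by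
    rw [Real.log_rpow (hs n), small, Real.log_div (hN n).ne' (hf n).ne']
    ring
  have h1 := Real.log_le_log (Real.rpow_pos_of_pos (hs q) _)
    (h (mem_Ici.2 hp) (mem_Ici.2 (hp.trans hpq)) hpq)
  simp only [hlog] at h1
  have h2 : Real.log (q.factorial : ℝ) / q ≤ Real.log q := by
    rw [div_le_iff₀' hq0]; exact log_factorial_le q
  have h3 : Real.log p - 1 ≤ Real.log (p.factorial : ℝ) / p := by
    rw [le_div_iff₀ hp0]
    linarith [mul_log_sub_le_log_factorial hp0 p]
  linarith

lemma quot_pos (hN : ∀ p, 0 < N p) (p : ℕ) : 0 < quot N p := by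
  unfold quot
  split_ifs
  exacts [one_pos, div_pos (hN _) (hN _)]

lemma log_succ_eq (hN : ∀ p, 0 < N p) (p : ℕ) :
    Real.log (N (p + 1)) = Real.log (N p) + Real.log (quot N (p + 1)) := by
  rw [← Real.log_mul (hN p).ne' (quot_pos hN _).ne', quot, if_neg p.succ_ne_zero,
    Nat.add_sub_cancel, mul_div_cancel₀ _ (hN p).ne']

lemma LogConvex.quot_le_succ (hN : ∀ p, 0 < N p) (h : LogConvex N) {p : ℕ} (hp : 1 ≤ p) :
    quot N p ≤ quot N (p + 1) := by
  rw [quot, quot, if_neg (by omega), if_neg (by omega), Nat.add_sub_cancel,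
    div_le_div_iff₀ (hN _) (hN _)]
  have := h p hp
  nlinarith

lemma LogConvex.log_le (hN : ∀ p, 0 < N p) (h : LogConvex N) (p : ℕ) :
    Real.log (N p) ≤ Real.log (N 0) + p * Real.log (quot N p) := by
  induction p with
  | zero => simp
  | succ p ih =>
    rw [log_succ_eq hN p]
    rcases Nat.eq_zero_or_pos p with rfl | hp
    · simp
    · have h1 := Real.log_le_log (quot_pos hN p) (h.quot_le_succ hN hp)
      have h2 := mul_le_mul_of_nonneg_left h1 (Nat.cast_nonneg (α := ℝ) p)
      push_cast
      linarith

/-- Multiplying `ν_k ≥ k ν_p / (H p)` over `k ≤ p` gives `N_p ≥ N_0 p! (ν_p / (H p))^p`, and `p! ≥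
(p/e)^p`. -/
lemma le_log_of_almostDecreasing_quot (hN : ∀ p, 0 < N p) {H : ℝ} (hH : 1 ≤ H)
    (h : ∀ p q : ℕ, 1 ≤ p → p ≤ q → quot N q / q ≤ H * (quot N p / p)) {p : ℕ} (hp : 1 ≤ p) :
    Real.log (N 0) + p * (Real.log (quot N p) - 1 - Real.log H) ≤ Real.log (N p) := by
  have hp0 : (0 : ℝ) < p := by exact_mod_cast hp
  have hH0 : 0 < H := by linarith
  have key : ∀ k : ℕ, k ≤ p → Real.log (N 0) +
      k * (Real.log (quot N p) - Real.log p - Real.log H) + Real.log (k.factorial : ℝ) ≤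
        Real.log (N k) := by
    intro k
    induction k with
    | zero => intro _; simp
    | succ k ih =>
      intro hk
      have hk0 : (0 : ℝ) < (k + 1 : ℕ) := by positivity
      have h1 := ih (by omega)
      have h2 := Real.log_le_log (div_pos (quot_pos hN p) hp0) (h (k + 1) p (by omega) hk)
      rw [Real.log_div (quot_pos hN p).ne' hp0.ne',
        Real.log_mul hH0.ne' (div_pos (quot_pos hN _) hk0).ne',
        Real.log_div (quot_pos hN _).ne' hk0.ne'] at h2
      have hf : (k.factorial : ℝ) ≠ 0 := by exact_mod_cast k.factorial_ne_zero
      rw [log_succ_eq hN k, Nat.factorial_succ, Nat.cast_mul, Real.log_mul hk0.ne' hf]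
      push_cast at h2 ⊢
      linarith
  have h1 := key p le_rfl
  have h2 := mul_log_sub_le_log_factorial hp0 p
  linarith

/-- Log-convexity bounds the root by the quotient from above, and the almost decreasing property
does so from below. The terms in `N 0` appear because `N` need not be normalized. -/
lemma rootAlmostDecreasing_of_quot (hN : ∀ p, 0 < N p) (hc : LogConvex N)
    (h : AlmostDecreasing (fun p : ℕ => quot N p / (p : ℝ))) : RootAlmostDecreasing N := by
  obtain ⟨H, hH, h⟩ := h
  refine ⟨2 * |Real.log (N 0)| + 2 * Real.log H + 1, fun p q hp hpq => ?_⟩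
  have hp1 : (1 : ℝ) ≤ p := by exact_mod_cast hp
  have hq1 : (1 : ℝ) ≤ q := by exact_mod_cast hp.trans hpq
  have hp0 : (0 : ℝ) < p := by linarith
  have hq0 : (0 : ℝ) < q := by linarith
  have h1 : Real.log (N q) / q ≤ |Real.log (N 0)| + Real.log (quot N q) := by
    rw [div_le_iff₀ hq0]
    have := hc.log_le hN q
    have := le_abs_self (Real.log (N 0))
    have := le_mul_of_one_le_right (abs_nonneg (Real.log (N 0))) hq1
    linarith
  have h2 : Real.log (quot N p) - 1 - Real.log H - |Real.log (N 0)| ≤ Real.log (N p) / p := by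
    rw [le_div_iff₀ hp0]
    have := le_log_of_almostDecreasing_quot hN hH h hp
    have := neg_abs_le (Real.log (N 0))
    have := le_mul_of_one_le_right (abs_nonneg (Real.log (N 0))) hp1
    linarith
  have h3 := Real.log_le_log (div_pos (quot_pos hN q) hq0) (h p q hp hpq)
  simp only at h3
  rw [Real.log_div (quot_pos hN q).ne' hq0.ne',
    Real.log_mul (by linarith) (div_pos (quot_pos hN _) hp0).ne',
    Real.log_div (quot_pos hN _).ne' hp0.ne'] at h3
  linarith

/-- Superlinearity of `log M_p` is the form of the hypothesis that survives `O(p)` perturbations,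
hence equivalence. -/
lemma tendsto_root_atTop (hM : ∀ p, 0 < M p)
    (h : ∀ B : ℝ, ∃ D : ℝ, ∀ p : ℕ, 1 ≤ p → B * p - D ≤ Real.log (M p)) :
    Tendsto (fun p : ℕ => (M p) ^ (1 / (p : ℝ))) atTop atTop := by
  rw [tendsto_atTop]
  intro b
  obtain ⟨D, hD⟩ := h (b + 1)
  filter_upwards [eventually_ge_atTop 1,
    tendsto_natCast_atTop_atTop.eventually_ge_atTop D] with p hp hpD
  have hp0 : (0 : ℝ) < p := by exact_mod_cast hp
  rw [Real.rpow_def_of_pos (hM p), mul_one_div]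
  have h1 : b ≤ Real.log (M p) / p := by
    rw [le_div_iff₀ hp0]
    linarith [hD p hp]
  linarith [Real.add_one_le_exp (Real.log (M p) / p)]

lemma SeqPreceq.log_lower (hM : ∀ p, 0 < M p) (hN : ∀ p, 0 < N p) (h : SeqPreceq M N)
    (hlow : ∀ B : ℝ, ∃ D : ℝ, ∀ p : ℕ, 1 ≤ p → B * p - D ≤ Real.log (M p)) (B : ℝ) :
    ∃ D : ℝ, ∀ p : ℕ, 1 ≤ p → B * p - D ≤ Real.log (N p) := by
  obtain ⟨c, hc⟩ := (seqPreceq_iff hM hN).1 h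
  obtain ⟨D, hD⟩ := hlow (B + c)
  exact ⟨D, fun p hp => by linarith [hc p hp, hD p hp]⟩

end Roots

/-! ### Regularization -/

section Regularization

/-- The largest non-increasing minorant of `p ↦ ψ_p / p`. -/
noncomputable def antitoneMinorant (ψ : ℕ → ℝ) : ℕ → ℝ
  | 0 => ψ 1
  | p + 1 => min (antitoneMinorant ψ p) (ψ (p + 1) / ((p + 1 : ℕ) : ℝ))

/-- The sequence with quotients `p α_p / ψ_1`, where `α = antitoneMinorant ψ`. -/
noncomputable def regularized (ψ : ℕ → ℝ) : ℕ → ℝ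
  | 0 => 1
  | p + 1 => regularized ψ p * (((p + 1 : ℕ) : ℝ) * (antitoneMinorant ψ (p + 1) / ψ 1))

variable {ψ : ℕ → ℝ}

lemma antitoneMinorant_pos (h0 : ∀ p, 0 < ψ p) (p : ℕ) : 0 < antitoneMinorant ψ p := by
  induction p with
  | zero => exact h0 1
  | succ p ih => exact lt_min ih (div_pos (h0 _) (by positivity))

lemma antitone_antitoneMinorant : Antitone (antitoneMinorant ψ) :=
  antitone_nat_of_succ_le fun _ => min_le_left _ _

lemma mul_antitoneMinorant_le (h0 : ∀ p, 0 < ψ p) (p : ℕ) : p * antitoneMinorant ψ p ≤ ψ p := by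
  rcases p with _ | p
  · simpa using (h0 0).le
  · rw [← le_div_iff₀' (by positivity)]
    exact min_le_right _ _

/-- Here `(p+1) α_{p+1}` is the minimum of `(p+1) α_p` and `ψ_{p+1}`, and both dominate `p α_p`. -/
lemma mul_antitoneMinorant_le_succ (h0 : ∀ p, 0 < ψ p) (hmono : ∀ p, 1 ≤ p → ψ p ≤ ψ (p + 1))
    (p : ℕ) :
    p * antitoneMinorant ψ p ≤ ((p + 1 : ℕ) : ℝ) * antitoneMinorant ψ (p + 1) := by
  rcases Nat.eq_zero_or_pos p with rfl | hp
  · simpa using (antitoneMinorant_pos h0 1).le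
  rw [antitoneMinorant, mul_min_of_nonneg _ _ (by positivity), mul_div_cancel₀ _ (by positivity)]
  refine le_min ?_ ((mul_antitoneMinorant_le h0 p).trans (hmono p hp))
  have := antitoneMinorant_pos h0 p
  gcongr
  omega

/-- The minorant loses at most the factor `H`. Only `q = p` is needed later; arbitrary `q ≥ p` makes
the induction close. -/
lemma div_le_mul_antitoneMinorant {H : ℝ} (hH : 0 ≤ H)
    (h : ∀ p q : ℕ, 1 ≤ p → p ≤ q → ψ q / q ≤ H * (ψ p / p)) (p : ℕ) :
    ∀ q : ℕ, 1 ≤ q → p ≤ q → ψ q / q ≤ H * antitoneMinorant ψ p := by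
  induction p with
  | zero =>
    intro q hq _
    simpa [antitoneMinorant] using h 1 q le_rfl hq
  | succ p ih =>
    intro q hq hpq
    rw [antitoneMinorant, mul_min_of_nonneg _ _ hH]
    exact le_min (ih q hq (by omega)) (h (p + 1) q (by omega) hpq)

lemma regularized_pos (h0 : ∀ p, 0 < ψ p) (p : ℕ) : 0 < regularized ψ p := by
  induction p with
  | zero => exact one_pos
  | succ p ih =>
    exact mul_pos ih (mul_pos (by positivity) (div_pos (antitoneMinorant_pos h0 _) (h0 1)))

lemma regularized_one (h0 : ∀ p, 0 < ψ p) : regularized ψ 1 = 1 := by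
  simp [regularized, antitoneMinorant, (h0 1).ne']

lemma quot_regularized (h0 : ∀ p, 0 < ψ p) {p : ℕ} (hp : 1 ≤ p) :
    quot (regularized ψ) p = p * (antitoneMinorant ψ p / ψ 1) := by
  obtain ⟨p, rfl⟩ := Nat.exists_eq_succ_of_ne_zero (by omega : p ≠ 0)
  rw [quot, if_neg p.succ_ne_zero, Nat.succ_sub_one, regularized,
    mul_div_cancel_left₀ _ (regularized_pos h0 p).ne']

lemma logConvex_regularized (h0 : ∀ p, 0 < ψ p) (hmono : ∀ p, 1 ≤ p → ψ p ≤ ψ (p + 1)) :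
    LogConvex (regularized ψ) := by
  intro p hp
  obtain ⟨p, rfl⟩ := Nat.exists_eq_succ_of_ne_zero (by omega : p ≠ 0)
  have h1 := mul_antitoneMinorant_le_succ h0 hmono (p + 1)
  have h2 := regularized_pos h0 p
  have h3 := regularized_pos h0 (p + 1)
  have h4 := div_le_div_of_nonneg_right h1 (h0 1).le
  have e2 : regularized ψ (p + 1 + 1) = regularized ψ (p + 1) *
    (((p + 1 + 1 : ℕ) : ℝ) * antitoneMinorant ψ (p + 1 + 1) / ψ 1) := by
    rw [mul_div_assoc]; rfl
  have e1 : regularized ψ (p + 1) ^ 2 = regularized ψ p *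
      (regularized ψ (p + 1) * (((p + 1 : ℕ) : ℝ) * antitoneMinorant ψ (p + 1) / ψ 1)) := by
    rw [sq]
    nth_rewrite 1 [regularized]
    ring
  rw [Nat.succ_sub_one, Nat.succ_eq_add_one, e2, e1]
  gcongr

lemma logConcave_small_regularized (h0 : ∀ p, 0 < ψ p) :
    LogConcave (small (regularized ψ)) := by
  have hs : ∀ p, 0 < small (regularized ψ) p := fun p =>
    div_pos (regularized_pos h0 p) (by exact_mod_cast p.factorial_pos)
  have hstep : ∀ p, small (regularized ψ) (p + 1) =
      small (regularized ψ) p * (antitoneMinorant ψ (p + 1) / ψ 1) := fun p => by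
    have : (p.factorial : ℝ) ≠ 0 := by exact_mod_cast p.factorial_ne_zero
    have : ((p + 1 : ℕ) : ℝ) ≠ 0 := by positivity
    rw [small, small, regularized, Nat.factorial_succ, Nat.cast_mul]
    field_simp
  intro p hp
  obtain ⟨p, rfl⟩ := Nat.exists_eq_succ_of_ne_zero (by omega : p ≠ 0)
  have h1 := div_le_div_of_nonneg_right
    (antitone_antitoneMinorant (ψ := ψ) (Nat.le_succ (p + 1))) (h0 1).le
  have h2 := hs p
  have h3 := hs (p + 1)
  rw [Nat.succ_sub_one, Nat.succ_eq_add_one, hstep (p + 1)]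
  calc _ = small (regularized ψ) (p + 1) * (small (regularized ψ) p *
        (antitoneMinorant ψ (p + 1 + 1) / ψ 1)) := by ring
    _ ≤ small (regularized ψ) (p + 1) * (small (regularized ψ) p *
        (antitoneMinorant ψ (p + 1) / ψ 1)) := by gcongr
    _ = _ := by rw [← hstep, sq]

/-- The quotients of the regularized sequence divided by `p` are truly non-increasing, so its roots
are comparable with its quotients `p α_p / ψ_1`, and these with `ψ_p`. -/
lemma abs_log_regularized_sub_le (h0 : ∀ p, 0 < ψ p) (hmono : ∀ p, 1 ≤ p → ψ p ≤ ψ (p + 1))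
    {H : ℝ} (hH : 1 ≤ H) (h : ∀ p q : ℕ, 1 ≤ p → p ≤ q → ψ q / q ≤ H * (ψ p / p))
    {p : ℕ} (hp : 1 ≤ p) :
    |Real.log (regularized ψ p) - p * Real.log (ψ p)| ≤
      (1 + Real.log H + |Real.log (ψ 1)|) * p := by
  have hp0 : (0 : ℝ) < p := by exact_mod_cast hp
  have hpos := regularized_pos h0
  have hα := antitoneMinorant_pos h0
  have hv0 : Real.log (regularized ψ 0) = 0 := Real.log_one
  have hup := (logConvex_regularized h0 hmono).log_le hpos p
  have hlow := le_log_of_almostDecreasing_quot hpos le_rfl (fun p q hp hpq => ?_) hp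
  · rw [hv0, zero_add, quot_regularized h0 hp] at hup hlow
    rw [Real.log_one, sub_zero] at hlow
    have e : Real.log (p * (antitoneMinorant ψ p / ψ 1)) =
        Real.log (p * antitoneMinorant ψ p) - Real.log (ψ 1) := by
      rw [← mul_div_assoc, Real.log_div (mul_pos hp0 (hα p)).ne' (h0 1).ne']
    rw [e] at hup hlow
    have h1 : Real.log (p * antitoneMinorant ψ p) ≤ Real.log (ψ p) :=
      Real.log_le_log (mul_pos hp0 (hα p)) (mul_antitoneMinorant_le h0 p)
    have h2 : Real.log (ψ p) ≤ Real.log H + Real.log (p * antitoneMinorant ψ p) := by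
      rw [← Real.log_mul (by linarith) (mul_pos hp0 (hα p)).ne']
      refine Real.log_le_log (h0 p) ?_
      have := div_le_mul_antitoneMinorant (by linarith) h p p hp le_rfl
      rw [div_le_iff₀ hp0] at this
      linarith
    have h3 := mul_le_mul_of_nonneg_left h1 hp0.le
    have h4 := mul_le_mul_of_nonneg_left h2 hp0.le
    have h5 := mul_le_mul_of_nonneg_left (le_abs_self (Real.log (ψ 1))) hp0.le
    have h6 := mul_le_mul_of_nonneg_left (neg_abs_le (Real.log (ψ 1))) hp0.le
    have h7 := mul_nonneg hp0.le (Real.log_nonneg hH)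
    rw [abs_le]
    constructor <;> linarith
  · have hp0 : (0 : ℝ) < p := by exact_mod_cast hp
    have hq0 : (0 : ℝ) < q := by exact_mod_cast hp.trans hpq
    rw [quot_regularized h0 hp, quot_regularized h0 (hp.trans hpq), one_mul,
      mul_div_cancel_left₀ _ hp0.ne', mul_div_cancel_left₀ _ hq0.ne']
    exact div_le_div_of_nonneg_right (antitone_antitoneMinorant hpq) (h0 1).le

/-- A sequence whose roots are non-decreasing and almost decreasing after division by `p` is
equivalent to a log-convex sequence `V` such that `V_p / p!` is log-concave. -/
lemma RootAlmostDecreasing.exists_regularization {M : ℕ → ℝ} (hM : ∀ p, 0 < M p)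
    (hmono : ∀ p : ℕ, 1 ≤ p →
      Real.log (M p) / p ≤ Real.log (M (p + 1)) / ((p + 1 : ℕ) : ℝ))
    (h : RootAlmostDecreasing M) :
    ∃ V : ℕ → ℝ, (∀ p, 0 < V p) ∧ V 0 = 1 ∧ V 1 = 1 ∧ SeqEquiv V M ∧ LogConvex V ∧
      LogConcave (small V) := by
  obtain ⟨C, hC⟩ := h
  -- The roots `M_p^{1/p}` serve as the model for the new quotients. Division by zero makes `ψ 0 =
  -- 1`, of which only positivity matters.
  set ψ : ℕ → ℝ := fun p => Real.exp (Real.log (M p) / p) with hψ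
  have h0 : ∀ p, 0 < ψ p := fun p => Real.exp_pos _
  have hm : ∀ p, 1 ≤ p → ψ p ≤ ψ (p + 1) := fun p hp => Real.exp_le_exp.2 (hmono p hp)
  have hH : ∀ p q : ℕ, 1 ≤ p → p ≤ q → ψ q / q ≤ Real.exp |C| * (ψ p / p) := by
    intro p q hp hpq
    have hp0 : (0 : ℝ) < p := by exact_mod_cast hp
    have hq0 : (0 : ℝ) < q := by exact_mod_cast hp.trans hpq
    rw [← Real.log_le_log_iff (div_pos (h0 q) hq0) (mul_pos (Real.exp_pos _) (div_pos (h0 p) hp0)),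
      Real.log_mul (Real.exp_pos _).ne' (div_pos (h0 p) hp0).ne', Real.log_exp,
      Real.log_div (h0 q).ne' hq0.ne', Real.log_div (h0 p).ne' hp0.ne', hψ]
    simp only [Real.log_exp]
    linarith [hC p q hp hpq, le_abs_self C]
  have hpos := regularized_pos h0
  obtain ⟨c, habs⟩ : ∃ c : ℝ, ∀ p : ℕ, 1 ≤ p →
      |Real.log (regularized ψ p) - Real.log (M p)| ≤ c * p := by
    refine ⟨1 + Real.log (Real.exp |C|) + |Real.log (ψ 1)|, fun p hp => ?_⟩
    have hp0 : (0 : ℝ) < p := by exact_mod_cast hp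
    have h1 := abs_log_regularized_sub_le h0 hm (Real.one_le_exp (abs_nonneg C)) hH hp
    have e : p * Real.log (ψ p) = Real.log (M p) := by
      rw [hψ]
      simp only [Real.log_exp]
      field_simp
    rwa [e] at h1
  refine ⟨regularized ψ, hpos, rfl, regularized_one h0,
    ⟨(seqPreceq_iff hpos hM).2 ⟨c, fun p hp => ?_⟩, (seqPreceq_iff hM hpos).2 ⟨c, fun p hp => ?_⟩⟩,
    logConvex_regularized h0 hm, logConcave_small_regularized h0⟩
  · linarith [(abs_le.1 (habs p hp)).2]
  · linarith [(abs_le.1 (habs p hp)).1]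

end Regularization

/-! ### Almost decreasing roots of the weight matrix -/

section MatrixRoots

variable {ω : ℝ → ℝ} {l : ℝ}

lemma log_matrixW_div (hl : 0 < l) (p : ℕ) :
    Real.log (matrixW ω l p) / p = young ω (l * p) / (l * p) := by
  rw [log_matrixW]
  field_simp

lemma InW0.log_matrixW_div_mono (hω : InW0 ω) (hl : 0 < l) {p q : ℕ} (hp : 1 ≤ p) (hpq : p ≤ q) :
    Real.log (matrixW ω l p) / p ≤ Real.log (matrixW ω l q) / q := by
  have hp0 : (0 : ℝ) < p := by exact_mod_cast hp
  rw [log_matrixW_div hl, log_matrixW_div hl]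
  exact hω.young_div_le (by positivity) (by gcongr)

lemma InW0.logConvex_matrixW (hω : InW0 ω) (hl : 0 < l) : LogConvex (matrixW ω l) := by
  intro p hp
  obtain ⟨p, rfl⟩ := Nat.exists_eq_succ_of_ne_zero (by omega : p ≠ 0)
  rw [Nat.succ_sub_one, Nat.succ_eq_add_one, ← Real.log_le_log_iff (pow_pos (matrixW_pos _) 2)
    (mul_pos (matrixW_pos _) (matrixW_pos _)), Real.log_pow,
    Real.log_mul (matrixW_pos _).ne' (matrixW_pos _).ne', log_matrixW, log_matrixW, log_matrixW]
  have h1 := hω.young_midpoint (x := l * p) (x' := l * (p + 1 + 1 : ℕ)) (by positivity)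
    (by positivity)
  have e : (l * p + l * (p + 1 + 1 : ℕ)) / 2 = l * (p + 1 : ℕ) := by push_cast; ring
  rw [e] at h1
  have := mul_le_mul_of_nonneg_left h1 (by positivity : 0 ≤ 1 / l)
  push_cast at this ⊢
  linarith

lemma InW0.log_matrixW_lower (hω : InW0 ω) (hl : 0 < l) (B : ℝ) :
    ∃ D : ℝ, ∀ p : ℕ, 1 ≤ p → B * p - D ≤ Real.log (matrixW ω l p) := by
  refine ⟨1 / l * ω (Real.exp B), fun p _ => ?_⟩
  have h1 := hω.le_young (x := l * p) (by positivity) B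
  have h2 := mul_le_mul_of_nonneg_left h1 (by positivity : 0 ≤ 1 / l)
  have e : 1 / l * (l * p * B - ω (Real.exp B)) = B * p - 1 / l * ω (Real.exp B) := by field_simp
  rw [log_matrixW]
  linarith

/-- Here `t = o(ω(t))` is decisive: `l * exp B * t ≤ ω t + const` for every `B` forces `p!/W_p` to
grow faster than `exp(B p)`. -/
lemma InW0.log_seqConj_matrixW_lower (hω : InW0 ω) (h : (fun t : ℝ => t) =o[atTop] ω)
    (hl : 0 < l) (B : ℝ) :
    ∃ D : ℝ, ∀ p : ℕ, 1 ≤ p → B * p - D ≤ Real.log (seqConj (matrixW ω l) p) := by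
  obtain ⟨D, hD, hle⟩ := hω.id_le h (c := 1 / (l * Real.exp B)) (by positivity)
  refine ⟨Real.exp B * D, fun p _ => ?_⟩
  have h1 : young ω (l * p) ≤ l * (Real.log (p.factorial : ℝ) - B * p + Real.exp B * D) := by
    refine young_le fun y _ => ?_
    have h2 := mul_log_sub_le_log_factorial (Real.exp_pos (y + B)) p
    rw [Real.log_exp, Real.exp_add] at h2
    have h3 := mul_le_mul_of_nonneg_left h2 hl.le
    have h4 := mul_le_mul_of_nonneg_left (hle (Real.exp y) (Real.exp_pos y).le)
      (by positivity : 0 ≤ l * Real.exp B)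
    have e : l * Real.exp B * (1 / (l * Real.exp B) * ω (Real.exp y) + D) =
      ω (Real.exp y) + l * Real.exp B * D := by field_simp
    linarith
  have h5 := mul_le_mul_of_nonneg_left h1 (by positivity : 0 ≤ 1 / l)
  rw [one_div, inv_mul_cancel_left₀ hl.ne'] at h5
  rw [log_seqConj matrixW_pos, log_matrixW, one_div]
  linarith

/-- Each step from `x` to `Q * x` raises `φ*(x)/x` by `log Q` up to a summable error. So it grows
like `log x` at most along geometric progressions, and monotonicity fills the gaps. -/
lemma InW0.rootAlmostDecreasing_matrixW (hω : InW0 ω) (hl : 0 < l) {Q D : ℝ} (hQ : 1 < Q)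
    (hD : 0 ≤ D) (h : ∀ t, 0 ≤ t → Q * ω t ≤ ω (Q * t) + D) :
    RootAlmostDecreasing (matrixW ω l) := by
  have hQ0 : 0 < Q := by linarith
  have hlQ := Real.log_pos hQ
  -- With `E + D = Q * E`, the shifted function `φ* + E` satisfies the dilation inequality without
  -- additive constant.
  set E := D / (Q - 1) with hE
  have hE0 : 0 ≤ E := div_nonneg hD (by linarith)
  have hDE : E + D = Q * E := by
    have : Q - 1 ≠ 0 := by linarith
    rw [hE]; field_simp; ring
  have iter : ∀ (n : ℕ) (x : ℝ), 0 ≤ x →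
      young ω (Q ^ n * x) + E ≤ Q ^ n * (young ω x + E + n * x * Real.log Q) := by
    intro n x hx
    induction n with
    | zero => simp
    | succ n ih =>
      have h1 := hω.young_dilate hQ.le hQ0 h (x := Q ^ n * x) (by positivity)
      have h2 := mul_le_mul_of_nonneg_left ih hQ0.le
      rw [pow_succ', mul_assoc]
      push_cast
      linarith
  refine ⟨E / l + Real.log Q, fun p q hp hpq => ?_⟩
  have hp1 : (1 : ℝ) ≤ p := by exact_mod_cast hp
  have hp0 : (0 : ℝ) < p := by linarith
  have hpq' : (p : ℝ) ≤ q := by exact_mod_cast hpq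
  have hq0 : (0 : ℝ) < q := by linarith
  obtain ⟨n, hn1, hn2⟩ := exists_nat_pow_near ((one_le_div hp0).2 hpq') hQ
  rw [div_lt_iff₀ hp0] at hn2
  have hn3 : n * Real.log Q ≤ Real.log q - Real.log p := by
    rw [← Real.log_pow, ← Real.log_div hq0.ne' hp0.ne']
    exact Real.log_le_log (by positivity) hn1
  have h1 := hω.young_div_le (x := l * q) (x' := Q ^ (n + 1) * (l * p)) (by positivity)
    (by rw [mul_left_comm]; gcongr)
  have h2 := iter (n + 1) (l * p) (by positivity)
  rw [log_matrixW_div hl, log_matrixW_div hl]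
  have h3 : E / (l * p) ≤ E / l := by
    rw [← div_div]; exact div_le_self (by positivity) hp1
  calc young ω (l * q) / (l * q) ≤ young ω (Q ^ (n + 1) * (l * p)) / (Q ^ (n + 1) * (l * p)) := h1
    _ ≤ Q ^ (n + 1) * (young ω (l * p) + E + (n + 1 : ℕ) * (l * p) * Real.log Q) /
        (Q ^ (n + 1) * (l * p)) := by gcongr; linarith
    _ = young ω (l * p) / (l * p) + E / (l * p) + (n * Real.log Q + Real.log Q) := by
        push_cast; field_simp; try ring
    _ ≤ _ := by linarith

/-- The constant `c` does not depend on `R`, which is essential for the index bound. Rounding `x /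
l` down to `p` and `R * x / l` up to `q` gives `q ≤ 4 * R * p`, whence `log 4`. -/
lemma RootAlmostDecreasing.young_dilate (hω : InW0 ω) (hl : 0 < l)
    (h : RootAlmostDecreasing (matrixW ω l)) :
    ∃ c : ℝ, 0 ≤ c ∧ ∀ R : ℝ, 1 ≤ R → ∃ D : ℝ, 0 ≤ D ∧ ∀ x, 0 ≤ x →
      young ω (R * x) ≤ R * young ω x + R * x * (Real.log R + c) + D := by
  obtain ⟨C, hC⟩ := h
  have hl4 : 0 ≤ Real.log 4 := Real.log_nonneg (by norm_num)
  refine ⟨|C| + Real.log 4, by positivity, fun R hR => ?_⟩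
  have hR0 : 0 < R := by linarith
  have hlR := Real.log_nonneg hR
  refine ⟨young ω (R * l), hω.young_nonneg (by positivity), fun x hx => ?_⟩
  -- For `x < l` the rounded index would be `0`; there `D` alone suffices.
  rcases le_total x l with hxl | hxl
  · have h1 := hω.young_mono (by positivity) (mul_le_mul_of_nonneg_left hxl hR0.le)
    have h2 := hω.young_nonneg hx
    have : 0 ≤ R * young ω x + R * x * (Real.log R + (|C| + Real.log 4)) := by positivity
    linarith
  have hx0 : 0 < x := by linarith
  have hxl1 : 1 ≤ x / l := (one_le_div hl).2 hxl
  set p := ⌊x / l⌋₊ with hp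
  set q := ⌈R * x / l⌉₊ with hq
  have hp1 : 1 ≤ p := Nat.le_floor (by simpa using hxl1)
  have hpx : (p : ℝ) ≤ x / l := Nat.floor_le (by positivity)
  have hpx' : x / l < p + 1 := Nat.lt_floor_add_one _
  have hRx : x / l ≤ R * x / l := by
    rw [mul_div_assoc]; exact le_mul_of_one_le_left (by positivity) hR
  have hqx : R * x / l ≤ q := Nat.le_ceil _
  have hqx' : (q : ℝ) < R * x / l + 1 := Nat.ceil_lt_add_one (by positivity)
  have hp1' : (1 : ℝ) ≤ p := by exact_mod_cast hp1
  have hp0 : (0 : ℝ) < p := by linarith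
  have hpq : p ≤ q := by exact_mod_cast (hpx.trans (hRx.trans hqx))
  have hq0 : (0 : ℝ) < q := by exact_mod_cast hp1.trans hpq
  have hq4 : (q : ℝ) ≤ R * 4 * p := by
    have h1 : x / l ≤ 2 * p := by linarith
    have h2 := mul_le_mul_of_nonneg_left h1 hR0.le
    rw [← mul_div_assoc] at h2
    linarith
  have h1 := Real.log_le_log hq0 hq4
  rw [Real.log_mul (by positivity) hp0.ne', Real.log_mul hR0.ne' (by norm_num)] at h1
  have h2 := hC p q hp1 hpq
  rw [log_matrixW_div hl, log_matrixW_div hl] at h2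
  have h3 := hω.young_div_le (x := R * x) (x' := l * q) (by positivity)
    (by rwa [div_le_iff₀' hl] at hqx)
  have h4 := hω.young_div_le (x := l * p) (x' := x) (by positivity)
    (by rwa [le_div_iff₀' hl] at hpx)
  have h5 : young ω (R * x) / (R * x) ≤ young ω x / x + (Real.log R + (|C| + Real.log 4)) := by
    linarith [le_abs_self C]
  rw [div_le_iff₀ (by positivity)] at h5
  have e : (young ω x / x + (Real.log R + (|C| + Real.log 4))) * (R * x) =
      R * young ω x + R * x * (Real.log R + (|C| + Real.log 4)) := by field_simp
  have := hω.young_nonneg (x := R * l) (by positivity)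
  linarith

lemma RootAlmostDecreasing.dilate (hω : InW0 ω) (hl : 0 < l)
    (h : RootAlmostDecreasing (matrixW ω l)) :
    ∃ c : ℝ, 0 ≤ c ∧ ∀ R : ℝ, 1 ≤ R → ∃ D : ℝ, ∀ t, 0 ≤ t →
      R * ω t ≤ ω (Real.exp (Real.log R + c) * t) + D := by
  obtain ⟨c, hc, hy⟩ := h.young_dilate hω hl
  refine ⟨c, hc, fun R hR => ?_⟩
  obtain ⟨D, hD, hx⟩ := hy R hR
  exact ⟨D, fun t ht => hω.dilate_of_young hR hD hx ht⟩

lemma RootAlmostDecreasing.om6 (hω : InW0 ω) (hl : 0 < l)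
    (h : RootAlmostDecreasing (matrixW ω l)) : Om6 ω := by
  obtain ⟨c, -, hc⟩ := h.dilate hω hl
  obtain ⟨D, hD⟩ := hc 2 one_le_two
  exact om6_of_dilate hω.monotoneOn (Real.exp_pos _).le hD

/-- For `γ > 1` take `A = exp b` and `R = exp (b + 1)`, so that `R > A`. The dilation is `exp (b + 1
+ c)`, and it equals `A ^ γ` when `b = (c + 1)/(γ - 1)`. -/
lemma RootAlmostDecreasing.gammaBar_le_one (hω : InW0 ω) (hl : 0 < l)
    (h : RootAlmostDecreasing (matrixW ω l)) : gammaBar ω ≤ 1 := by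
  obtain ⟨c, hc0, hc⟩ := h.dilate hω hl
  refine le_of_forall_gt_imp_ge_of_dense fun a ha => ?_
  obtain ⟨γ, hγ1, hγa⟩ := EReal.lt_iff_exists_real_btwn.1 ha
  refine le_trans ?_ hγa.le
  have hγ : 1 < γ := by exact_mod_cast hγ1
  set b := (c + 1) / (γ - 1) with hb
  have hb0 : 0 < b := div_pos (by linarith) (by linarith)
  have hbγ : γ * b = b + c + 1 := by
    have : γ - 1 ≠ 0 := by linarith
    rw [hb]; field_simp; ring
  obtain ⟨D, hD⟩ := hc (Real.exp (b + 1)) (Real.one_le_exp (by linarith))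
  refine gammaBar_le_of_pBar (by linarith) (pBar_of_dilate hω.tendsto (A := Real.exp b)
    (B := Real.exp (b + 1)) (D := D) (by simpa using hb0) (Real.exp_lt_exp.2 (by linarith))
    fun t ht => ?_)
  have := hD t ht
  rw [Real.log_exp] at this
  rwa [← Real.exp_mul, mul_comm b, hbγ, add_right_comm]

end MatrixRoots

/-! ### Equivalence of the conjugate functions, and regular representatives of the matrix members.
-/

section Conclusions

variable {ω : ℝ → ℝ} {l : ℝ}

lemma InW0.funEquiv_conj_assoc_matrixW (hω : InW0 ω) (hC : ConjWellDefined ω)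
    (h : Om1 (conj ω)) (hl : 0 < l) :
    FunEquiv (conj ω) (conj (assoc (matrixW ω l))) ∧ Om1 (conj (assoc (matrixW ω l))) := by
  obtain ⟨D, hD1, hD⟩ := hω.exists_le_assoc_matrixW hl
  have h1 := hω.eq_zero 1 ⟨zero_le_one, le_rfl⟩
  have hnn : ∀ s, 0 ≤ s → 0 ≤ conj ω s := fun s hs => hs.trans (hC.self_le_conj h1 hs)
  have hlow : ∀ s, 0 ≤ s → conj ω (s * l) ≤ l * conj (assoc (matrixW ω l)) s := fun s hs => by
    have := hω.conj_le_conj_assoc_matrixW hC hl hs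
    rwa [one_div_mul_eq_div, div_le_iff₀' hl] at this
  have hτ : ∀ s, 0 ≤ s → 0 ≤ conj (assoc (matrixW ω l)) s := fun s hs =>
    nonneg_of_mul_nonneg_right ((hnn _ (by positivity)).trans (hlow s hs)) hl
  have hD0 : 0 ≤ D / (2 * l) := by positivity
  have hl2 : 0 ≤ 1 / (2 * l) := by positivity
  refine h.of_dilation_equiv (fun s hs _ _ => hC.conj_mono hs) hnn (hC.tendsto_conj h1) hτ
    (a := l) (b := 2 * l) (C := l + 1 / (2 * l) + D / (2 * l)) hl (by positivity) (by positivity)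
    (fun s hs => ?_) (fun s hs => ?_)
  · have := hτ s hs
    rw [mul_comm]
    nlinarith [hlow s hs]
  · have h3 : conj (assoc (matrixW ω l)) s ≤ 1 / (2 * l) * conj ω (2 * l * s) + D / (2 * l) :=
      conj_le fun t ht => sub_assoc_matrixW_le hl hC hD hs ht
    have := hnn (2 * l * s) (by positivity)
    nlinarith

lemma InW0.funEquiv_conj_assoc_seqConj (hω : InW0 ω) (hC : ConjWellDefined ω)
    (h : Om1 (conj ω)) (hl : 0 < l) :
    FunEquiv (conj ω) (assoc (seqConj (matrixW ω l))) ∧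
      Om1 (assoc (seqConj (matrixW ω l))) := by
  have h1 := hω.eq_zero 1 ⟨zero_le_one, le_rfl⟩
  have hnn : ∀ s, 0 ≤ s → 0 ≤ conj ω s := fun s hs => hs.trans (hC.self_le_conj h1 hs)
  have hτ : ∀ t, 0 ≤ t → 0 ≤ assoc (seqConj (matrixW ω l)) t := fun t ht =>
    (hω.assocWellDefined_seqConj hC hl).assoc_nonneg (seqConj_pos matrixW_pos 0) ht
  have hl4 : 0 ≤ Real.log 4 := Real.log_nonneg (by norm_num)
  have hl1 : 0 ≤ 1 / l := by positivity
  refine h.of_dilation_equiv (fun s hs _ _ => hC.conj_mono hs) hnn (hC.tendsto_conj h1) hτ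
    (a := l / 2) (b := l) (C := l * (1 + Real.log 4) + 1 / l) (by positivity) hl (by positivity)
    (fun t ht => ?_) (fun t ht => ?_)
  · have h2 := hω.conj_le_assoc_seqConj hC hl ht
    have h3 := mul_nonneg hl.le (hτ t ht)
    have h4 := mul_nonneg h3 hl4
    have h5 := mul_nonneg hl1 (hτ t ht)
    nlinarith
  · have h2 := hω.assoc_seqConj_le hC hl ht
    have h3 := hnn (l * t) (by positivity)
    have h4 : 0 ≤ l * (1 + Real.log 4) := by positivity
    nlinarith

/-- Since `V*_p` is the inverse of `V_p/p!`, log-concavity of the latter is log-convexity of `V*`.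
The normalization `V_0 = V_1 = 1` serves both sequences. -/
lemma InW0.exists_inLC (hω : InW0 ω) (h : (fun t : ℝ => t) =o[atTop] ω) (hl : 0 < l)
    (hr : RootAlmostDecreasing (matrixW ω l)) :
    ∃ V : ℕ → ℝ, SeqEquiv V (matrixW ω l) ∧ LogConvex V ∧ LogConcave (small V) ∧
      InLC V ∧ InLC (seqConj V) := by
  obtain ⟨V, hV, hV0, hV1, hVW, hcv, hcc⟩ := hr.exists_regularization matrixW_pos
    fun p hp => hω.log_matrixW_div_mono hl hp (Nat.le_succ p)
  have hV' := seqConj_pos hV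
  have hsmall : ∀ p, seqConj V p = (small V p)⁻¹ := fun p => by rw [seqConj, small, inv_div]
  have hspos : ∀ p, 0 < small V p := fun p => by
    have := hV' p
    rwa [hsmall, inv_pos] at this
  refine ⟨V, hVW, hcv, hcc,
    ⟨⟨hV, tendsto_root_atTop hV (hVW.2.log_lower matrixW_pos hV (hω.log_matrixW_lower hl))⟩,
      hV0, hV1.ge, hcv⟩,
    ⟨⟨hV', tendsto_root_atTop hV' ((hVW.1.seqConj hV matrixW_pos).log_lower
      (seqConj_pos matrixW_pos) hV' (hω.log_seqConj_matrixW_lower h hl))⟩,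
      by simp [seqConj, hV0], by simp [seqConj, hV1], fun p hp => ?_⟩⟩
  rw [hsmall, hsmall, hsmall, inv_pow, ← mul_inv]
  exact inv_anti₀ (mul_pos (hspos _) (hspos _)) (hcc p hp)

lemma exists_rootAlmostDecreasing (hω : InW0 ω)
    (h : (∃ l₀ : ℝ, 0 < l₀ ∧ AlmostDecreasing (fun p : ℕ => quot (matrixW ω l₀) p / (p : ℝ))) ∨
      (Om1 ω ∧ ∃ l₀ : ℝ, 0 < l₀ ∧ ∃ N : ℕ → ℝ, IsWeightSequence N ∧ LogConvex N ∧
        SeqEquiv (matrixW ω l₀) N ∧ AlmostDecreasing (fun p : ℕ => quot N p / (p : ℝ)))) :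
    ∃ l₀ : ℝ, 0 < l₀ ∧ RootAlmostDecreasing (matrixW ω l₀) := by
  rcases h with ⟨l, hl, h⟩ | ⟨-, l, hl, N, hN, hc, he, h⟩
  · exact ⟨l, hl, rootAlmostDecreasing_of_quot matrixW_pos (hω.logConvex_matrixW hl) h⟩
  · exact ⟨l, hl, (rootAlmostDecreasing_of_quot hN.pos hc h).congr hN.pos matrixW_pos ⟨he.2, he.1⟩⟩

end Conclusions

end BMT

theorem theorem5p5 (ω : ℝ → ℝ) (hω : BMT.InW0 ω)
    (hC2 : (fun t : ℝ => t) =o[atTop] ω) :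
    -- all suprema that define the objects below are finite
    (BMT.YoungWellDefined ω ∧ BMT.ConjWellDefined ω ∧
      ∀ l : ℝ, 0 < l →
        BMT.AssocWellDefined (BMT.matrixW ω l) ∧
        BMT.ConjWellDefined (BMT.assoc (BMT.matrixW ω l)) ∧
        BMT.AssocWellDefined (BMT.seqConj (BMT.matrixW ω l))) ∧
    -- (i)
    (∀ l : ℝ, 0 < l → ∃ D : ℝ, 1 ≤ D ∧
      (∀ t : ℝ, 0 ≤ t →
        l * BMT.assoc (BMT.matrixW ω l) t ≤ ω t ∧
        ω t ≤ 2 * l * BMT.assoc (BMT.matrixW ω l) t + D) ∧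
      (∀ s : ℝ, 0 ≤ s →
        1 / l * BMT.conj ω (s * l) ≤ BMT.conj (BMT.assoc (BMT.matrixW ω l)) s ∧
        BMT.conj (BMT.assoc (BMT.matrixW ω l)) s
          ≤ 1 / (2 * l) * BMT.conj ω (2 * l * s) + D / (2 * l))) ∧
    -- (ii)
    (BMT.gammaBar ω < 1 →
      -- (a)
      BMT.Om1 (BMT.conj ω) ∧
      -- (b)
      (∀ l : ℝ, 0 < l →
        BMT.FunEquiv (BMT.conj ω) (BMT.conj (BMT.assoc (BMT.matrixW ω l))) ∧
        BMT.Om1 (BMT.conj (BMT.assoc (BMT.matrixW ω l)))) ∧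
      -- (c)
      (∀ l : ℝ, 0 < l →
        BMT.Om1 (BMT.assoc (BMT.seqConj (BMT.matrixW ω l))) ∧
        BMT.FunEquiv (BMT.conj ω) (BMT.conj (BMT.assoc (BMT.matrixW ω l))) ∧
        BMT.FunEquiv (BMT.conj (BMT.assoc (BMT.matrixW ω l)))
          (BMT.assoc (BMT.seqConj (BMT.matrixW ω l)))) ∧
      -- (d)
      (BMT.ConstantMatrix (BMT.matrixW ω) ∧ BMT.ConstantMatrix (BMT.matrixWConj ω) ∧
        ∀ l : ℝ, 0 < l →
          BMT.ModerateGrowth (BMT.matrixW ω l) ∧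
          BMT.ModerateGrowth (BMT.seqConj (BMT.matrixW ω l))) ∧
      -- (e)
      (∀ l : ℝ, 0 < l → ∃ V : ℕ → ℝ,
        BMT.SeqEquiv V (BMT.matrixW ω l) ∧ BMT.LogConvex V ∧
        BMT.LogConcave (BMT.small V) ∧ BMT.InLC V ∧ BMT.InLC (BMT.seqConj V)) ∧
      -- (f)
      (BMT.Om1 ω → BMT.gammaBar (BMT.conj ω) < 1 ∧ BMT.Om6 (BMT.conj ω))) ∧
    -- (iii)
    (((∃ l₀ : ℝ, 0 < l₀ ∧
          BMT.AlmostDecreasing (fun p : ℕ => BMT.quot (BMT.matrixW ω l₀) p / (p : ℝ))) ∨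
        (BMT.Om1 ω ∧ ∃ l₀ : ℝ, 0 < l₀ ∧ ∃ N : ℕ → ℝ,
          BMT.IsWeightSequence N ∧ BMT.LogConvex N ∧
          BMT.SeqEquiv (BMT.matrixW ω l₀) N ∧
          BMT.AlmostDecreasing (fun p : ℕ => BMT.quot N p / (p : ℝ))) ∨
        (∃ l₀ : ℝ, 0 < l₀ ∧ ∃ N : ℕ → ℝ,
          (∀ p, 0 < N p) ∧ BMT.LogConvex N ∧
          BMT.SeqEquiv N (BMT.matrixW ω l₀) ∧
          AntitoneOn (fun p : ℕ => (BMT.small N p) ^ (1 / (p : ℝ))) (Ici 1))) →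
      BMT.ConstantMatrix (BMT.matrixW ω) ∧ BMT.ConstantMatrix (BMT.matrixWConj ω) ∧
        BMT.Om6 ω) ∧
    (((∃ l₀ : ℝ, 0 < l₀ ∧
          BMT.AlmostDecreasing (fun p : ℕ => BMT.quot (BMT.matrixW ω l₀) p / (p : ℝ))) ∨
        (BMT.Om1 ω ∧ ∃ l₀ : ℝ, 0 < l₀ ∧ ∃ N : ℕ → ℝ,
          BMT.IsWeightSequence N ∧ BMT.LogConvex N ∧
          BMT.SeqEquiv (BMT.matrixW ω l₀) N ∧
          BMT.AlmostDecreasing (fun p : ℕ => BMT.quot N p / (p : ℝ)))) →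
      BMT.gammaBar ω ≤ 1) := by
  have hC := hω.conjWellDefined hC2
  have h1 := hω.eq_zero 1 ⟨zero_le_one, le_rfl⟩
  have hnn : ∀ t, 0 ≤ t → 0 ≤ ω t := fun _ => hω.nonneg
  refine ⟨⟨hω.youngWellDefined, hC, fun l hl => ⟨hω.assocWellDefined_matrixW hl,
    hω.conjWellDefined_assoc_matrixW hC hl, hω.assocWellDefined_seqConj hC hl⟩⟩,
    fun l hl => ?_, fun hγ => ?_, fun h => ?_, fun h => ?_⟩
  · obtain ⟨D, hD1, hD⟩ := hω.exists_le_assoc_matrixW hl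
    exact ⟨D, hD1, fun t ht => ⟨hω.mul_assoc_matrixW_le hl ht, hD t ht⟩, fun s hs =>
      ⟨hω.conj_le_conj_assoc_matrixW hC hl hs,
        BMT.conj_le fun t ht => BMT.sub_assoc_matrixW_le hl hC hD hs ht⟩⟩
  -- This inequality drives all of (ii): the factor `2 * Q` is used in full for doubling of `ω*`,
  -- weakened to `2` for `(ω₆)`, and to `Q` for the roots.
  · obtain ⟨Q, D, hQ, hD, hdil⟩ :=
      BMT.exists_dilate_of_gammaBar_lt_one hω.monotoneOn hnn hω.tendsto hγ
    have hom1 : BMT.Om1 (BMT.conj ω) := hC.om1_conj h1 hQ hD hdil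
    have hom6 : BMT.Om6 ω := BMT.om6_of_dilate hω.monotoneOn (by linarith) fun t ht =>
      le_trans (mul_le_mul_of_nonneg_right (by linarith) (hnn t ht)) (hdil t ht)
    have hroot : ∀ l : ℝ, 0 < l → BMT.RootAlmostDecreasing (BMT.matrixW ω l) := fun l hl =>
      hω.rootAlmostDecreasing_matrixW hl hQ hD fun t ht =>
        le_trans (mul_le_mul_of_nonneg_right (by linarith) (hnn t ht)) (hdil t ht)
    refine ⟨hom1, fun l hl => hω.funEquiv_conj_assoc_matrixW hC hom1 hl, fun l hl => ?_,
      ⟨hom6.constantMatrix hω, hom6.constantMatrix_conj hω, fun l hl =>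
        ⟨hom6.moderateGrowth hω hl, hω.moderateGrowth_seqConj hl⟩⟩,
      fun l hl => hω.exists_inLC hC2 hl (hroot l hl), fun h => ?_⟩
    · obtain ⟨e1, -⟩ := hω.funEquiv_conj_assoc_matrixW hC hom1 hl
      obtain ⟨e2, o2⟩ := hω.funEquiv_conj_assoc_seqConj hC hom1 hl
      exact ⟨o2, e1, e1.symm.trans e2⟩
    · obtain ⟨R, E, hR, hE⟩ := h.exists_dilate_conj hnn hC
      refine ⟨BMT.gammaBar_lt_one_of_dilate (hC.tendsto_conj h1) hR hE,
        BMT.om6_of_dilate (fun s hs _ _ => hC.conj_mono hs) (by linarith) fun s hs =>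
          le_trans (mul_le_mul_of_nonneg_right (by linarith) ?_) (hE s hs)⟩
      exact hs.trans (hC.self_le_conj h1 hs)
  · obtain ⟨l, hl, hr⟩ : ∃ l : ℝ, 0 < l ∧ BMT.RootAlmostDecreasing (BMT.matrixW ω l) := by
      rcases h with h | h | ⟨l, hl, N, hN, -, he, ha⟩
      · exact BMT.exists_rootAlmostDecreasing hω (Or.inl h)
      · exact BMT.exists_rootAlmostDecreasing hω (Or.inr h)
      · exact ⟨l, hl,
          (BMT.rootAlmostDecreasing_of_antitone hN ha).congr hN BMT.matrixW_pos he⟩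
    have hom6 := hr.om6 hω hl
    exact ⟨hom6.constantMatrix hω, hom6.constantMatrix_conj hω, hom6⟩
  · obtain ⟨l, hl, hr⟩ := BMT.exists_rootAlmostDecreasing hω h
    exact hr.gammaBar_le_one hω hl
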